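/- There are $n$ jobs, all available at time $0$, with unknown processing times $p_1,\dots,p_n>0$, to be scheduled preemptively on $m\ge 1$ parallel identical machines. A schedule assigns to each job $j$ at each time $t\ge 0$ a rate $R_j^t\in[0,1]$ (measurable in $t$, and zero once the job is completed) with $\sum_j R_j^t\le m$. The elapsed time of $j$ is $e_j(t)=\int_0^t R_j^{s}\,\mathrm{d}s$, its completion time $C_j$ is the earliest $t$ with $e_j(t)\ge p_j$, the objective is to minimize $\sum_j C_j$, and $\mathrm{OPT}$ is the optimal (offline) objective value. A fraction $\alpha\in(0,1]$ is announced, and job $j$ emits a single signal when $e_j(t)$ reaches $\beta_j p_j$, where $\beta_j\in[0,1]$ is unknown. A (deterministic) non-clairvoyant algorithm knows $m$, $n$ and $\alpha$, and chooses the rates at time $t$ from what it has observed during $[0,t]$, namely which jobs have emitted their signal or completed, and when. With $\mathrm{ALG}$ the objective value of its schedule, it is $c$-consistent if $\mathrm{ALG}\le c\cdot\mathrm{OPT}$ on every instance with $\beta_j=\alpha$ for all $j$, and $c$-robust if $\mathrm{ALG}\le c\cdot\mathrm{OPT}$ on every instance. **Theorem.** For every $m\ge1$ and every $\alpha\in(0,1]$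 there is a non-clairvoyant algorithm that is $(1+\alpha)$-consistent and $(1+\tfrac1\alpha)$-robust. More precisely, the following Round-Robin/queue algorithm has these properties. It keeps a set $E$, initially containing all jobs, a FIFO queue $Q$, initially empty, and the set $S$ of the first (at most) $m$ jobs of $Q$. Every job in $S$ is processed at rate $1$, every job in $E$ at rate $\min\{1,(m-|S|)/|E|\}$, and no other job is processed. When a job $j\in E$ emits its signal, at elapsed time $\rho_j$, it moves from $E$ to the end of $Q$ (simultaneous signals are ordered by job index). When it has spent $\rho_j(1-\alpha)/\alpha$ time units in $S$, it moves from $Q$ back to $E$. Completed jobs are removed. -/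

import Mathlib

open MeasureTheory
open scoped ENNReal

noncomputable section

namespace SignalScheduling

/-- `n` jobs, all available at time `0`. Job `j` has processing time `p j > 0` and emits its single
signal once a fraction `β j ∈ [0,1]` of it has been processed. -/
structure JobInstance (n : ℕ) where
  p : Fin n → ℝ
  β : Fin n → ℝ
  p_pos : ∀ j, 0 < p j
  β_nonneg : ∀ j, 0 ≤ β j
  β_le_one : ∀ j, β j ≤ 1

/-- The processing `e_j(t)` that job `j` has received until time `t` under the rates `R`. -/
def elapsed {n : ℕ} (R : Fin n → ℝ → ℝ) (j : Fin n) (t : ℝ) : ℝ :=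
  ∫ s in (0 : ℝ)..t, R j s

/-- Job `j` is completed at time `t`. -/
def Completed {n : ℕ} (p : Fin n → ℝ) (R : Fin n → ℝ → ℝ) (j : Fin n) (t : ℝ) : Prop :=
  p j ≤ elapsed R j t

/-- Job `j` has emitted its signal by time `t`. -/
def Signalled {n : ℕ} (I : JobInstance n) (R : Fin n → ℝ → ℝ) (j : Fin n) (t : ℝ) : Prop :=
  I.β j * I.p j ≤ elapsed R j t

/-- `R` is a feasible (preemptive) schedule of jobs with processing times `p` on `m` identical
parallel machines, given by its processing rates: `R j t` is the rate of job `j` at time `t`. -/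
structure IsSchedule (m : ℕ) {n : ℕ} (p : Fin n → ℝ) (R : Fin n → ℝ → ℝ) : Prop where
  measurable : ∀ j, Measurable (R j)
  nonneg : ∀ j t, 0 ≤ t → 0 ≤ R j t
  le_one : ∀ j t, 0 ≤ t → R j t ≤ 1
  sum_le : ∀ t, 0 ≤ t → ∑ j, R j t ≤ m
  completed : ∀ j t, 0 ≤ t → Completed p R j t → R j t = 0

/-- The completion time `C_j`, which is `∞` if the job never completes. -/
def completionTime {n : ℕ} (p : Fin n → ℝ) (R : Fin n → ℝ → ℝ) (j : Fin n) : ℝ≥0∞ :=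
  ⨅ (t : ℝ) (_ : 0 ≤ t ∧ Completed p R j t), ENNReal.ofReal t

/-- The objective value `∑_j C_j`. -/
def totalCompletionTime {n : ℕ} (p : Fin n → ℝ) (R : Fin n → ℝ → ℝ) : ℝ≥0∞ :=
  ∑ j, completionTime p R j

/-- The optimal (offline) total completion time on `m` machines. -/
def opt (m : ℕ) {n : ℕ} (p : Fin n → ℝ) : ℝ≥0∞ :=
  ⨅ (R : Fin n → ℝ → ℝ) (_ : IsSchedule m p R), totalCompletionTime p R

/-- What the scheduler sees of a job at a given time. -/
structure JobStatus where
  signalled : Prop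
  completed : Prop

def status {n : ℕ} (I : JobInstance n) (R : Fin n → ℝ → ℝ) (j : Fin n) (t : ℝ) : JobStatus where
  signalled := Signalled I R j t
  completed := Completed I.p R j t

/-- A deterministic non-clairvoyant algorithm: the rates at time `t` are a function of the number
of jobs, of `t`, and of what has been observed during `[0,t]` (which jobs have emitted their signal
and which are completed, at each time in `[0,t]`). The processing times and the signal fractions
are not available to it. -/
def OnlineAlgorithm : Type :=
  (n : ℕ) → (t : ℝ) → (Fin n → Set.Icc (0 : ℝ) t → JobStatus) → Fin n → ℝ

/-- `R` is the feasible schedule that results from running the algorithm `A` on `I`. -/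
def OnlineAlgorithm.Produces (A : OnlineAlgorithm) (m : ℕ) {n : ℕ} (I : JobInstance n)
    (R : Fin n → ℝ → ℝ) : Prop :=
  IsSchedule m I.p R ∧
    ∀ t, 0 ≤ t → ∀ j, R j t = A n t (fun i s => status I R i s) j

/-- On every instance the algorithm does produce a feasible schedule for `m` machines. -/
def OnlineAlgorithm.IsAlgorithmFor (A : OnlineAlgorithm) (m : ℕ) : Prop :=
  ∀ (n : ℕ) (I : JobInstance n), ∃ R, A.Produces m I R

/-- The algorithm is `c`-consistent: it is within a factor `c` of the optimum on all instances
whose signals are accurate, i.e. emitted exactly at the announced fraction `α`. -/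
def OnlineAlgorithm.IsConsistent (A : OnlineAlgorithm) (m : ℕ) (α c : ℝ) : Prop :=
  ∀ (n : ℕ) (I : JobInstance n), (∀ j, I.β j = α) → ∀ R, A.Produces m I R →
    totalCompletionTime I.p R ≤ ENNReal.ofReal c * opt m I.p

/-- The algorithm is `c`-robust: it is within a factor `c` of the optimum on all instances,
whatever the signals. -/
def OnlineAlgorithm.IsRobust (A : OnlineAlgorithm) (m : ℕ) (c : ℝ) : Prop :=
  ∀ (n : ℕ) (I : JobInstance n) (R : Fin n → ℝ → ℝ), A.Produces m I R →
    totalCompletionTime I.p R ≤ ENNReal.ofReal c * opt m I.p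

/-- The time at which job `j` emits its signal (only used for jobs that do emit it). -/
def signalTime {n : ℕ} (I : JobInstance n) (R : Fin n → ℝ → ℝ) (j : Fin n) : ℝ :=
  sInf {t : ℝ | 0 ≤ t ∧ Signalled I R j t}

/-- The order of the FIFO queue: by signal emission, simultaneous signals by job index. -/
def QueuedBefore {n : ℕ} (I : JobInstance n) (R : Fin n → ℝ → ℝ) (i j : Fin n) : Prop :=
  signalTime I R i < signalTime I R j ∨ (signalTime I R i = signalTime I R j ∧ i < j)

/-- The amount of time up to `t` that job `j` has spent in the set `S`. -/
def timeIn {n : ℕ} (S : ℝ → Finset (Fin n)) (j : Fin n) (t : ℝ) : ℝ :=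
  volume.real {s : ℝ | s ∈ Set.Icc 0 t ∧ j ∈ S s}

open Classical in
/-- The schedule `R` is a run of the Round-Robin/queue rule with parameter `α` on `m` machines, with
`E t`, `Q t`, `S t` the contents at time `t` of the Round-Robin set `E`, the FIFO queue `Q`, and the
set `S` of the jobs in preferential execution.
* A job enters `Q` when it emits its signal, with `ρ_j` its elapsed time at that moment, and leaves
  `Q` when it is completed or has spent `ρ_j (1-α)/α` time units in `S`. All other unfinished jobs
  are in `E`.
* `S` consists of the first (at most) `m` jobs of the queue.
* Jobs in `S` run at rate `1`, jobs in `E` at the common rate `min {1, (m-|S|)/|E|}`, and no other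
  job is processed. -/
structure IsRoundRobinQueueRun (m : ℕ) (α : ℝ) {n : ℕ} (I : JobInstance n) (R : Fin n → ℝ → ℝ)
    (E Q S : ℝ → Finset (Fin n)) : Prop where
  mem_Q : ∀ t, 0 ≤ t → ∀ j, j ∈ Q t ↔
    ¬ Completed I.p R j t ∧ Signalled I R j t ∧
      timeIn S j t < elapsed R j (signalTime I R j) * ((1 - α) / α)
  mem_E : ∀ t, 0 ≤ t → ∀ j, j ∈ E t ↔ ¬ Completed I.p R j t ∧ j ∉ Q t
  mem_S : ∀ t, 0 ≤ t → ∀ j, j ∈ S t ↔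
    j ∈ Q t ∧ ((Q t).filter (fun i => QueuedBefore I R i j)).card < m
  rate_S : ∀ t, 0 ≤ t → ∀ j ∈ S t, R j t = 1
  rate_E : ∀ t, 0 ≤ t → ∀ j ∈ E t,
    R j t = min 1 (((m : ℝ) - ((S t).card : ℝ)) / ((E t).card : ℝ))
  rate_other : ∀ t, 0 ≤ t → ∀ j, j ∉ S t → j ∉ E t → R j t = 0

/-- All schedules of the algorithm follow the Round-Robin/queue rule. -/
def OnlineAlgorithm.IsRoundRobinQueue (A : OnlineAlgorithm) (m : ℕ) (α : ℝ) : Prop :=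
  ∀ (n : ℕ) (I : JobInstance n) (R : Fin n → ℝ → ℝ), A.Produces m I R →
    ∃ E Q S : ℝ → Finset (Fin n), IsRoundRobinQueueRun m α I R E Q S

end SignalScheduling

end

/-! The optimum is bounded through weights `⌊r/m⌋ + 1`, where `r` counts jobs from the end of the
completion order. While `k` jobs are unfinished, the objective grows at rate `k`. The weighted
remaining work of these jobs falls at rate at most `k`, by a knapsack argument: total rate at most
`m`, each single rate at most `1`. Hence every schedule costs at least `∑ (⌊r_j/m⌋ + 1) p_j` for
some order `r` (`exists_rank_sum_le`), and it suffices to compare the algorithm with such sums.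

Robustness. Outside `S` a job never runs faster than an unfinished job, and its time in `S` is at
most `(1-α)/α` times its processing outside `S`. So no job gets more than `1/α` times the processing
of an unfinished job (`elapsed_le_div`). Until the time `T` when at most `m` jobs remain, all
machines are busy, so `m` times a completion time truncated at `T` is the total processing done by
then. Summing over pairs of jobs, each pair costs at most `1 + 1/α` times the processing at `T` of
either member, and may be charged to the one of larger rank. After `T` all remaining jobs run at
rate `1` (`sum_le_robust`).

Consistency. With accurate signals the jobs of `S` are the shortest unfinished ones and stay queued
until they complete, so job `j` spends exactly `(1-α) p_j` in `S`. Let the weights follow the order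
of decreasing length. The number of unfinished jobs is at most the weighted rate of work, with work
in `S` counted once and work in `E` twice (`card_unfinished_le`). Integration gives `(1-α) + 2α = 1
+ α` per unit of weighted length, and shortest-first is the best order by rearrangement.

For the algorithm itself, the rule at time `t` depends only on rates before `t` and on statuses up
to `t`. A run is built from event to event, with at most `3n` events, and runs with equal
observations agree. The rates can therefore be read off any run compatible with the observations. -/

open Filter Topology

noncomputable section

namespace SignalScheduling

/-! ### Real induction, hitting times, elapsed time and time in `S`. -/

section

/-- If a property propagates from `[0, s)` to a right neighbourhood of `s`, for every `s ≥ 0`, then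
it holds on `[0, ∞)`. -/
theorem real_induction {P : ℝ → Prop}
    (h : ∀ s, 0 ≤ s → (∀ r, 0 ≤ r → r < s → P r) → ∀ᶠ r in 𝓝[≥] s, P r) :
    ∀ s, 0 ≤ s → P s := by
  by_contra! hcon
  obtain ⟨s₀, hs₀, hP₀⟩ := hcon
  set F : Set ℝ := {s | 0 ≤ s ∧ ¬ P s} with hF
  have hne : F.Nonempty := ⟨s₀, hs₀, hP₀⟩
  have hbdd : BddBelow F := ⟨0, fun s hs => hs.1⟩
  have h0 : 0 ≤ sInf F := le_csInf hne fun s hs => hs.1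
  have hlt : ∀ r, 0 ≤ r → r < sInf F → P r := by
    intro r hr hrs
    by_contra hPr
    exact absurd (csInf_le hbdd (show r ∈ F from ⟨hr, hPr⟩)) (not_le.2 hrs)
  have hev := h _ h0 hlt
  obtain ⟨u, hu, hsub⟩ := (mem_nhdsGE_iff_exists_Ico_subset).1 hev
  obtain ⟨r, hrF, hru⟩ := exists_lt_of_csInf_lt hne hu
  exact hrF.2 (hsub ⟨csInf_le hbdd hrF, hru⟩)

/-- A monotone function of slope at most one stays on the same side of a level for a while. -/
theorem eventually_le_iff_of_slope_le {f : ℝ → ℝ} {t : ℝ} (c : ℝ)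
    (hmono : ∀ r, t ≤ r → f t ≤ f r) (hlip : ∀ r, t ≤ r → f r ≤ f t + (r - t)) :
    ∀ᶠ r in 𝓝[≥] t, (c ≤ f r ↔ c ≤ f t) := by
  by_cases hc : c ≤ f t
  · filter_upwards [self_mem_nhdsWithin] with r hr
    exact iff_of_true (hc.trans (hmono r hr)) hc
  · push Not at hc
    have : Set.Ico t (t + (c - f t)) ∈ 𝓝[≥] t := Ico_mem_nhdsGE (by linarith)
    filter_upwards [this] with r hr
    have := hlip r hr.1
    have := hr.2
    exact iff_of_false (by linarith) (by linarith)

/-- A monotone function of slope at most one has a first time at which it reaches a level. -/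
theorem exists_first_time {f : ℝ → ℝ} {c t : ℝ}
    (hmono : ∀ s r, 0 ≤ s → s ≤ r → f s ≤ f r)
    (hlip : ∀ s r, 0 ≤ s → s ≤ r → f r ≤ f s + (r - s)) (ht : 0 ≤ t) (hc : c ≤ f t) :
    let τ := sInf {s | 0 ≤ s ∧ c ≤ f s}
    0 ≤ τ ∧ τ ≤ t ∧ c ≤ f τ ∧ (∀ s, 0 ≤ s → s < τ → f s < c) ∧ (f 0 ≤ c → f τ = c) := by
  intro τ
  have hne : {s | 0 ≤ s ∧ c ≤ f s}.Nonempty := ⟨t, ht, hc⟩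
  have hbdd : BddBelow {s | 0 ≤ s ∧ c ≤ f s} := ⟨0, fun s hs => hs.1⟩
  have h0 : 0 ≤ τ := le_csInf hne fun s hs => hs.1
  have hbefore : ∀ s, 0 ≤ s → s < τ → f s < c := by
    intro s hs hst
    by_contra! hcs
    exact absurd (csInf_le hbdd (show s ∈ {s | 0 ≤ s ∧ c ≤ f s} from ⟨hs, hcs⟩)) (not_le.2 hst)
  have hτ : c ≤ f τ := by
    by_contra! hlt
    have hev := eventually_le_iff_of_slope_le c (fun r hr => hmono τ r h0 hr)
      (fun r hr => hlip τ r h0 hr)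
    obtain ⟨u, hu, hsub⟩ := (mem_nhdsGE_iff_exists_Ico_subset).1 hev
    obtain ⟨r, hrF, hru⟩ := exists_lt_of_csInf_lt hne hu
    have := (hsub ⟨csInf_le hbdd hrF, hru⟩).1 hrF.2
    linarith
  refine ⟨h0, csInf_le hbdd ⟨ht, hc⟩, hτ, hbefore, fun hf0 => le_antisymm ?_ hτ⟩
  by_contra! hlt
  rcases h0.eq_or_lt with h | h
  · rw [← h] at hlt; linarith
  -- Slope at most one means that an overshoot `f τ - c` would have kept `f` at or above `c` for
  -- that long before `τ`.
  · set s := max 0 (τ - (f τ - c)) with hs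
    have hs0 : 0 ≤ s := le_max_left _ _
    have hsτ : s < τ := max_lt h (by linarith)
    have h1 := hbefore s hs0 hsτ
    have h2 := hlip s τ hs0 hsτ.le
    have h3 : τ - (f τ - c) ≤ s := le_max_right _ _
    linarith

variable {n : ℕ}

/-- Measurable processing rates in `[0,1]`. -/
structure UnitRates (R : Fin n → ℝ → ℝ) : Prop where
  measurable : ∀ j, Measurable (R j)
  nonneg : ∀ j t, 0 ≤ t → 0 ≤ R j t
  le_one : ∀ j t, 0 ≤ t → R j t ≤ 1

theorem IsSchedule.unitRates {m : ℕ} {p : Fin n → ℝ} {R : Fin n → ℝ → ℝ}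
    (h : IsSchedule m p R) : UnitRates R :=
  ⟨h.measurable, h.nonneg, h.le_one⟩

theorem intervalIntegrable_of_unit {f : ℝ → ℝ} (hf : Measurable f)
    (h0 : ∀ t, 0 ≤ t → 0 ≤ f t) (h1 : ∀ t, 0 ≤ t → f t ≤ 1) {s t : ℝ} (hs : 0 ≤ s) (ht : 0 ≤ t) :
    IntervalIntegrable f volume s t := by
  refine (intervalIntegrable_const (c := (1 : ℝ))).mono_fun hf.aestronglyMeasurable ?_
  refine (ae_restrict_iff' measurableSet_uIoc).2 (ae_of_all _ fun x hx => ?_)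
  have hx0 : 0 ≤ x := (le_min hs ht).trans (Set.uIoc_subset_uIcc hx).1
  show ‖f x‖ ≤ ‖(1 : ℝ)‖
  rw [Real.norm_of_nonneg (h0 x hx0)]
  simpa using h1 x hx0

/-- Inequality of interval integrals from an inequality inside the interval. -/
theorem integral_le_of_Ioo {f g : ℝ → ℝ} {a b : ℝ} (hab : a ≤ b)
    (hf : IntervalIntegrable f volume a b) (hg : IntervalIntegrable g volume a b)
    (h : ∀ x, a < x → x < b → f x ≤ g x) : ∫ x in a..b, f x ≤ ∫ x in a..b, g x :=
  intervalIntegral.integral_mono_on_of_le_Ioo hab hf hg fun x hx => h x hx.1 hx.2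

theorem integral_eq_of_Ioo {f g : ℝ → ℝ} {a b : ℝ} (hab : a ≤ b)
    (h : ∀ x, a < x → x < b → f x = g x) : ∫ x in a..b, f x = ∫ x in a..b, g x := by
  refine intervalIntegral.integral_congr_ae ?_
  have : ∀ᵐ x : ℝ, x ≠ b := by simp [ae_iff]
  filter_upwards [this] with x hxb hx
  rw [Set.uIoc_of_le hab] at hx
  exact h x hx.1 (lt_of_le_of_ne hx.2 hxb)

namespace UnitRates

variable {R : Fin n → ℝ → ℝ}

theorem intervalIntegrable (h : UnitRates R) (j : Fin n) {s t : ℝ} (hs : 0 ≤ s) (ht : 0 ≤ t) :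
    IntervalIntegrable (R j) volume s t :=
  intervalIntegrable_of_unit (h.measurable j) (h.nonneg j) (h.le_one j) hs ht

theorem elapsed_sub (h : UnitRates R) (j : Fin n) {s t : ℝ} (hs : 0 ≤ s) (ht : 0 ≤ t) :
    elapsed R j t - elapsed R j s = ∫ x in s..t, R j x :=
  intervalIntegral.integral_interval_sub_left (h.intervalIntegrable j le_rfl ht)
    (h.intervalIntegrable j le_rfl hs)

theorem elapsed_mono (h : UnitRates R) (j : Fin n) {s t : ℝ} (hs : 0 ≤ s) (hst : s ≤ t) :
    elapsed R j s ≤ elapsed R j t := by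
  have := h.elapsed_sub j hs (hs.trans hst)
  have h2 : 0 ≤ ∫ x in s..t, R j x :=
    intervalIntegral.integral_nonneg hst fun x hx => h.nonneg j x (hs.trans hx.1)
  linarith

theorem elapsed_lip (h : UnitRates R) (j : Fin n) {s t : ℝ} (hs : 0 ≤ s) (hst : s ≤ t) :
    elapsed R j t ≤ elapsed R j s + (t - s) := by
  have := h.elapsed_sub j hs (hs.trans hst)
  have h2 : ∫ x in s..t, R j x ≤ ∫ x in s..t, (1 : ℝ) :=
    integral_le_of_Ioo hst (h.intervalIntegrable j hs (hs.trans hst)) (by simp)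
      fun x hx _ => h.le_one j x (hs.trans hx.le)
  simp at h2
  linarith

theorem completed_mono (h : UnitRates R) {p : Fin n → ℝ} {j : Fin n} {s t : ℝ} (hs : 0 ≤ s)
    (hst : s ≤ t) (hc : Completed p R j s) : Completed p R j t :=
  le_trans hc (h.elapsed_mono j hs hst)

theorem signalled_mono (h : UnitRates R) {I : JobInstance n} {j : Fin n} {s t : ℝ} (hs : 0 ≤ s)
    (hst : s ≤ t) (hc : Signalled I R j s) : Signalled I R j t :=
  le_trans hc (h.elapsed_mono j hs hst)

theorem eventually_completed_iff (h : UnitRates R) (p : Fin n → ℝ) (j : Fin n) {t : ℝ}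
    (ht : 0 ≤ t) : ∀ᶠ r in 𝓝[≥] t, (Completed p R j r ↔ Completed p R j t) :=
  eventually_le_iff_of_slope_le _ (fun _ hr => h.elapsed_mono j ht hr)
    fun _ hr => h.elapsed_lip j ht hr

theorem eventually_signalled_iff (h : UnitRates R) (I : JobInstance n) (j : Fin n) {t : ℝ}
    (ht : 0 ≤ t) : ∀ᶠ r in 𝓝[≥] t, (Signalled I R j r ↔ Signalled I R j t) :=
  eventually_le_iff_of_slope_le _ (fun _ hr => h.elapsed_mono j ht hr)
    fun _ hr => h.elapsed_lip j ht hr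

end UnitRates

@[simp] theorem elapsed_zero (R : Fin n → ℝ → ℝ) (j : Fin n) : elapsed R j 0 = 0 := by
  simp [elapsed]

theorem elapsed_congr {R R' : Fin n → ℝ → ℝ} {j : Fin n} {t : ℝ} (ht : 0 ≤ t)
    (h : ∀ r, 0 ≤ r → r < t → R j r = R' j r) : elapsed R j t = elapsed R' j t :=
  integral_eq_of_Ioo ht fun x hx hxt => h x hx.le hxt

theorem JobInstance.signal_nonneg (I : JobInstance n) (j : Fin n) : 0 ≤ I.β j * I.p j :=
  mul_nonneg (I.β_nonneg j) (I.p_pos j).le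

theorem UnitRates.signalTime_spec {R : Fin n → ℝ → ℝ} (h : UnitRates R) {I : JobInstance n}
    {j : Fin n} {t : ℝ} (ht : 0 ≤ t) (hs : Signalled I R j t) :
    0 ≤ signalTime I R j ∧ signalTime I R j ≤ t ∧ Signalled I R j (signalTime I R j) ∧
      (∀ s, 0 ≤ s → s < signalTime I R j → ¬ Signalled I R j s) ∧
      elapsed R j (signalTime I R j) = I.β j * I.p j := by
  obtain ⟨h0, h1, h2, h3, h4⟩ := exists_first_time (f := elapsed R j)
    (fun s r hs hr => h.elapsed_mono j hs hr) (fun s r hs hr => h.elapsed_lip j hs hr) ht hs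
  exact ⟨h0, h1, h2, fun s hs hst => not_le.2 (h3 s hs hst),
    h4 (by simpa using I.signal_nonneg j)⟩

theorem UnitRates.completionTime_spec {R : Fin n → ℝ → ℝ} (h : UnitRates R) {p : Fin n → ℝ}
    (hp : ∀ j, 0 ≤ p j) {j : Fin n} {t : ℝ} (ht : 0 ≤ t) (hs : Completed p R j t) :
    ∃ C, 0 ≤ C ∧ C ≤ t ∧ Completed p R j C ∧ (∀ s, 0 ≤ s → s < C → ¬ Completed p R j s) ∧
      elapsed R j C = p j ∧ completionTime p R j = ENNReal.ofReal C := by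
  obtain ⟨h0, h1, h2, h3, h4⟩ := exists_first_time (f := elapsed R j)
    (fun s r hs hr => h.elapsed_mono j hs hr) (fun s r hs hr => h.elapsed_lip j hs hr) ht hs
  refine ⟨_, h0, h1, h2, fun s hs hst => not_le.2 (h3 s hs hst), h4 (by simpa using hp j), ?_⟩
  refine le_antisymm (iInf₂_le _ ⟨h0, h2⟩) (le_iInf₂ fun s hs => ENNReal.ofReal_le_ofReal ?_)
  by_contra! hlt
  exact absurd hs.2 (not_le.2 (h3 s hs.1 hlt))

section timeIn

variable {S S' : ℝ → Finset (Fin n)} {j : Fin n}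

theorem timeIn_set_ne_top (S : ℝ → Finset (Fin n)) (j : Fin n) (t : ℝ) :
    volume {s : ℝ | s ∈ Set.Icc 0 t ∧ j ∈ S s} ≠ ⊤ :=
  ne_top_of_le_ne_top (by simp) (measure_mono (t := Set.Icc 0 t) fun _ hs => hs.1)

theorem timeIn_nonneg (S : ℝ → Finset (Fin n)) (j : Fin n) (t : ℝ) : 0 ≤ timeIn S j t :=
  measureReal_nonneg

theorem timeIn_mono (S : ℝ → Finset (Fin n)) (j : Fin n) {s t : ℝ} (hst : s ≤ t) :
    timeIn S j s ≤ timeIn S j t :=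
  measureReal_mono (fun _ hx => ⟨⟨hx.1.1, hx.1.2.trans hst⟩, hx.2⟩) (timeIn_set_ne_top S j t)

/-- Subadditivity of the outer measure suffices, so `S` need not be measurable. This matters because
measurability of `S` is only derived later, for runs. -/
theorem timeIn_lip (S : ℝ → Finset (Fin n)) (j : Fin n) {s t : ℝ} (hst : s ≤ t) :
    timeIn S j t ≤ timeIn S j s + (t - s) := by
  have hsub : {x : ℝ | x ∈ Set.Icc 0 t ∧ j ∈ S x} ⊆
      {x : ℝ | x ∈ Set.Icc 0 s ∧ j ∈ S x} ∪ Set.Ioc s t := by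
    intro x hx
    rcases le_or_gt x s with h | h
    · exact Or.inl ⟨⟨hx.1.1, h⟩, hx.2⟩
    · exact Or.inr ⟨h, hx.1.2⟩
  have hfin : volume ({x : ℝ | x ∈ Set.Icc 0 s ∧ j ∈ S x} ∪ Set.Ioc s t) ≠ ⊤ :=
    measure_union_ne_top (timeIn_set_ne_top S j s) (by simp)
  have h1 := measureReal_mono hsub hfin
  have h2 := measureReal_union_le (μ := volume) {x : ℝ | x ∈ Set.Icc 0 s ∧ j ∈ S x} (Set.Ioc s t)
  have h3 : volume.real (Set.Ioc s t) = t - s := Real.volume_real_Ioc_of_le hst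
  unfold timeIn
  linarith

/-- The endpoint is a null set. Hence the rule, which defines `S t` through `timeIn S j t`, is not
circular. -/
theorem timeIn_congr {t : ℝ} (h : ∀ r, 0 ≤ r → r < t → S r = S' r) :
    timeIn S j t = timeIn S' j t := by
  unfold timeIn
  refine measureReal_congr ?_
  have : ∀ᵐ x : ℝ, x ≠ t := by simp [ae_iff]
  filter_upwards [this] with x hx
  refine propext (and_congr_right fun hx' => ?_)
  rw [h x hx'.1 (lt_of_le_of_ne hx'.2 hx)]

theorem timeIn_eq_zero {t : ℝ} (h : ∀ r, 0 ≤ r → r < t → j ∉ S r) : timeIn S j t = 0 := by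
  have h' : {s : ℝ | s ∈ Set.Icc 0 t ∧ j ∈ S s} ⊆ {t} := by
    intro x hx
    by_contra hne
    exact h x hx.1.1 (lt_of_le_of_ne hx.1.2 hne) hx.2
  refine le_antisymm ?_ (timeIn_nonneg _ _ _)
  calc timeIn S j t ≤ volume.real {t} := measureReal_mono h' (by simp)
    _ = 0 := by rw [measureReal_def, Real.volume_singleton, ENNReal.toReal_zero]

end timeIn

end

/-! ### The rule as a function of the past. -/

section

variable {n : ℕ}

section rule

open Classical in
/-- The jobs in the FIFO queue at time `t`. -/
def queueSet (α : ℝ) (I : JobInstance n) (R : Fin n → ℝ → ℝ) (S : ℝ → Finset (Fin n)) (t : ℝ) :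
    Finset (Fin n) :=
  Finset.univ.filter fun j => ¬ Completed I.p R j t ∧ Signalled I R j t ∧
    timeIn S j t < elapsed R j (signalTime I R j) * ((1 - α) / α)

open Classical in
/-- The first `m` jobs of the queue. -/
def headSet (m : ℕ) (α : ℝ) (I : JobInstance n) (R : Fin n → ℝ → ℝ) (S : ℝ → Finset (Fin n))
    (t : ℝ) : Finset (Fin n) :=
  (queueSet α I R S t).filter fun j =>
    ((queueSet α I R S t).filter fun i => QueuedBefore I R i j).card < m

open Classical in
/-- The jobs in the Round-Robin set. -/
def poolSet (α : ℝ) (I : JobInstance n) (R : Fin n → ℝ → ℝ) (S : ℝ → Finset (Fin n)) (t : ℝ) :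
    Finset (Fin n) :=
  Finset.univ.filter fun j => ¬ Completed I.p R j t ∧ j ∉ queueSet α I R S t

/-- The rates prescribed by the Round-Robin/queue rule. -/
def ruleRate (m : ℕ) (α : ℝ) (I : JobInstance n) (R : Fin n → ℝ → ℝ) (S : ℝ → Finset (Fin n))
    (t : ℝ) (j : Fin n) : ℝ :=
  if j ∈ headSet m α I R S t then 1
  else if j ∈ poolSet α I R S t then
    min 1 (((m : ℝ) - ((headSet m α I R S t).card : ℝ)) / ((poolSet α I R S t).card : ℝ))
  else 0

variable {m : ℕ} {α : ℝ} {I I' : JobInstance n} {R R' : Fin n → ℝ → ℝ}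
  {S S' : ℝ → Finset (Fin n)}

theorem mem_queueSet {t : ℝ} {j : Fin n} : j ∈ queueSet α I R S t ↔
    ¬ Completed I.p R j t ∧ Signalled I R j t ∧
      timeIn S j t < elapsed R j (signalTime I R j) * ((1 - α) / α) := by
  simp [queueSet]

theorem mem_poolSet {t : ℝ} {j : Fin n} : j ∈ poolSet α I R S t ↔
    ¬ Completed I.p R j t ∧ j ∉ queueSet α I R S t := by
  simp [poolSet]

theorem headSet_subset {t : ℝ} : headSet m α I R S t ⊆ queueSet α I R S t :=
  Finset.filter_subset _ _

/-- The rule depends only on the set of completed jobs, the queue, and its order. -/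
theorem rule_congr {t t' : ℝ}
    (hC : ∀ j, Completed I.p R j t ↔ Completed I'.p R' j t')
    (hQ : ∀ j, j ∈ queueSet α I R S t ↔ j ∈ queueSet α I' R' S' t')
    (hB : ∀ i j, i ∈ queueSet α I R S t → j ∈ queueSet α I R S t →
      (QueuedBefore I R i j ↔ QueuedBefore I' R' i j)) :
    headSet m α I R S t = headSet m α I' R' S' t' ∧
      ruleRate m α I R S t = ruleRate m α I' R' S' t' := by
  classical
  have hQ' : queueSet α I R S t = queueSet α I' R' S' t' := Finset.ext hQ
  have hE : poolSet α I R S t = poolSet α I' R' S' t' := by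
    ext j
    rw [mem_poolSet, mem_poolSet, hC, hQ']
  have hS : headSet m α I R S t = headSet m α I' R' S' t' := by
    unfold headSet
    rw [← hQ']
    refine Finset.filter_congr fun j hj => ?_
    rw [Finset.filter_congr fun i hi => hB i j hi hj]
  refine ⟨hS, ?_⟩
  funext j
  unfold ruleRate
  rw [hS, hE]

/-- The moment of a past signal is determined by the past. -/
theorem signalTime_congr (hR : UnitRates R) (hR' : UnitRates R') {t : ℝ} (ht : 0 ≤ t) {j : Fin n}
    (hG : ∀ r, 0 ≤ r → r ≤ t → (Signalled I R j r ↔ Signalled I' R' j r))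
    (hr : ∀ r, 0 ≤ r → r < t → R j r = R' j r) (hj : Signalled I R j t) :
    signalTime I R j = signalTime I' R' j ∧
      elapsed R j (signalTime I R j) = elapsed R' j (signalTime I' R' j) := by
  have hj' := (hG t ht le_rfl).1 hj
  have hσ : signalTime I R j = signalTime I' R' j := by
    unfold signalTime
    congr 1
    ext r
    refine and_congr_right fun hr0 => ?_
    rcases le_total r t with h | h
    · exact hG r hr0 h
    -- Times after `t` lie in both sets, so the infima are decided on `[0,t]`.
    · exact iff_of_true (hR.signalled_mono ht h hj) (hR'.signalled_mono ht h hj')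
  obtain ⟨h0, h1, -⟩ := hR.signalTime_spec ht hj
  exact ⟨hσ, hσ ▸ elapsed_congr h0 fun r h2 h3 => hr r h2 (h3.trans_le h1)⟩

/-- The rule at time `t` depends only on what happened before `t` and on the statuses up to `t`. -/
theorem rule_congr_of_past (hR : UnitRates R) (hR' : UnitRates R') {t : ℝ} (ht : 0 ≤ t)
    (hC : ∀ j, Completed I.p R j t ↔ Completed I'.p R' j t)
    (hG : ∀ j r, 0 ≤ r → r ≤ t → (Signalled I R j r ↔ Signalled I' R' j r))
    (hr : ∀ j r, 0 ≤ r → r < t → R j r = R' j r) (hs : ∀ r, 0 ≤ r → r < t → S r = S' r) :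
    headSet m α I R S t = headSet m α I' R' S' t ∧
      ruleRate m α I R S t = ruleRate m α I' R' S' t := by
  have hσ := fun j hj => signalTime_congr hR hR' ht (hG j) (hr j) hj
  have hQ : ∀ j, j ∈ queueSet α I R S t ↔ j ∈ queueSet α I' R' S' t := by
    intro j
    rw [mem_queueSet, mem_queueSet, hC j, ← hG j t ht le_rfl, timeIn_congr hs]
    exact and_congr_right fun _ => and_congr_right fun hj => by rw [(hσ j hj).2]
  refine rule_congr hC hQ fun i j hi hj => ?_
  unfold QueuedBefore
  rw [(hσ i (mem_queueSet.1 hi).2.1).1, (hσ j (mem_queueSet.1 hj).2.1).1]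

/-- Job `j` has used up its time in preferential execution by time `t`. -/
def Expired (α : ℝ) (I : JobInstance n) (R : Fin n → ℝ → ℝ) (S : ℝ → Finset (Fin n)) (j : Fin n)
    (t : ℝ) : Prop :=
  Signalled I R j t ∧ elapsed R j (signalTime I R j) * ((1 - α) / α) ≤ timeIn S j t

/-- The progress made at time `t`: which jobs are completed, have emitted their signal, and have
used up their time in preferential execution. -/
def SameProgress (α : ℝ) (I : JobInstance n) (R : Fin n → ℝ → ℝ) (S : ℝ → Finset (Fin n))
    (t t' : ℝ) : Prop :=
  ∀ j, (Completed I.p R j t ↔ Completed I.p R j t') ∧ (Signalled I R j t ↔ Signalled I R j t') ∧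
    (Expired α I R S j t ↔ Expired α I R S j t')

/-- Queue membership is a Boolean combination of the three events, and the FIFO order does not
involve the current time. Hence the prescribed rates are constant between events. -/
theorem SameProgress.rule_eq {t t' : ℝ} (h : SameProgress α I R S t t') :
    headSet m α I R S t = headSet m α I R S t' ∧
      ruleRate m α I R S t = ruleRate m α I R S t' := by
  refine rule_congr (fun j => (h j).1) (fun j => ?_) fun _ _ _ _ => Iff.rfl
  rw [mem_queueSet, mem_queueSet]
  obtain ⟨h1, h2, h3⟩ := h j
  unfold Expired at h3
  rw [← not_le, ← not_le]
  tauto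

theorem UnitRates.eventually_sameProgress (hR : UnitRates R) (α : ℝ) (I : JobInstance n)
    (S : ℝ → Finset (Fin n)) {t : ℝ} (ht : 0 ≤ t) :
    ∀ᶠ r in 𝓝[≥] t, SameProgress α I R S r t := by
  refine eventually_all.2 fun j => ?_
  have hT : ∀ᶠ r in 𝓝[≥] t, (elapsed R j (signalTime I R j) * ((1 - α) / α) ≤ timeIn S j r ↔
      elapsed R j (signalTime I R j) * ((1 - α) / α) ≤ timeIn S j t) :=
    eventually_le_iff_of_slope_le _ (fun _ hr => timeIn_mono S j hr) fun _ hr => timeIn_lip S j hr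
  filter_upwards [hR.eventually_completed_iff I.p j ht, hR.eventually_signalled_iff I j ht, hT]
    with r h1 h2 h3
  exact ⟨h1, h2, and_congr h2 h3⟩

/-- `R`, with `S` as the sets of preferred jobs, follows the Round-Robin/queue rule. -/
structure FollowsRule (m : ℕ) (α : ℝ) (I : JobInstance n) (R : Fin n → ℝ → ℝ)
    (S : ℝ → Finset (Fin n)) : Prop where
  unitRates : UnitRates R
  head : ∀ t, 0 ≤ t → S t = headSet m α I R S t
  rate : ∀ t, 0 ≤ t → ∀ j, R j t = ruleRate m α I R S t j

theorem FollowsRule.isRun (h : FollowsRule m α I R S) :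
    IsRoundRobinQueueRun m α I R (poolSet α I R S) (queueSet α I R S) S where
  mem_Q _ _ _ := mem_queueSet
  mem_E _ _ _ := mem_poolSet
  mem_S t ht j := by
    rw [h.head t ht, headSet, Finset.mem_filter]
  rate_S t ht j hj := by
    rw [h.rate t ht, ruleRate, if_pos (h.head t ht ▸ hj)]
  rate_E t ht j hj := by
    have hj' : j ∉ headSet m α I R S t := fun hS => (mem_poolSet.1 hj).2 (headSet_subset hS)
    rw [h.rate t ht, ruleRate, if_neg hj', if_pos hj, ← h.head t ht]
  rate_other t ht j hS hE := by
    rw [h.rate t ht, ruleRate, if_neg (h.head t ht ▸ hS), if_neg hE]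

/-- Runs that look the same until time `t` agree until time `t`. -/
theorem FollowsRule.eq_of_status_eq (h : FollowsRule m α I R S) (h' : FollowsRule m α I' R' S')
    {t : ℝ} (hst : ∀ j r, 0 ≤ r → r ≤ t → status I R j r = status I' R' j r) :
    ∀ r, 0 ≤ r → r ≤ t → S r = S' r ∧ ∀ j, R j r = R' j r := by
  refine real_induction fun s hs ih => ?_
  by_cases hts : t < s
  · filter_upwards [self_mem_nhdsWithin] with r hr hrt
    exact absurd (hts.trans_le hr) (not_lt.2 hrt)
  push Not at hts
  have hC : ∀ j r, 0 ≤ r → r ≤ t → (Completed I.p R j r ↔ Completed I'.p R' j r) :=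
    fun j r h0 h1 => iff_of_eq (congrArg JobStatus.completed (hst j r h0 h1))
  have hG : ∀ j r, 0 ≤ r → r ≤ t → (Signalled I R j r ↔ Signalled I' R' j r) :=
    fun j r h0 h1 => iff_of_eq (congrArg JobStatus.signalled (hst j r h0 h1))
  -- Agreement on `[0,s)` makes the two rules agree at `s`. Progress in each run is then frozen on a
  -- right neighbourhood of `s`, which carries the agreement past `s`.
  have key := rule_congr_of_past (m := m) (α := α) (S := S) (S' := S') h.unitRates h'.unitRates hs
    (fun j => hC j s hs hts) (fun j r h0 h1 => hG j r h0 (h1.trans hts))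
    (fun j r h0 h1 => (ih r h0 h1 (h1.le.trans hts)).2 j)
    (fun r h0 h1 => (ih r h0 h1 (h1.le.trans hts)).1)
  filter_upwards [self_mem_nhdsWithin, h.unitRates.eventually_sameProgress α I S hs,
    h'.unitRates.eventually_sameProgress α I' S' hs] with r hr h1 h2 _
  have hr0 : 0 ≤ r := hs.trans hr
  obtain ⟨h3, h4⟩ := h1.rule_eq (m := m)
  obtain ⟨h5, h6⟩ := h2.rule_eq (m := m)
  refine ⟨by rw [h.head r hr0, h'.head r hr0, h3, h5, key.1], fun j => ?_⟩
  rw [h.rate r hr0, h'.rate r hr0, h4, h6, key.2]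

end rule

/-! ### The online algorithm and the uniqueness of its schedules. -/

/-- An algorithm produces at most one schedule on each instance. -/
theorem OnlineAlgorithm.Produces.unique {A : OnlineAlgorithm} {m : ℕ} {I : JobInstance n}
    {R R' : Fin n → ℝ → ℝ} (h : A.Produces m I R) (h' : A.Produces m I R') :
    ∀ t, 0 ≤ t → ∀ j, R j t = R' j t := by
  have hR := h.1.unitRates
  have hR' := h'.1.unitRates
  refine real_induction fun s hs ih => ?_
  have he : ∀ j r, 0 ≤ r → r ≤ s → elapsed R j r = elapsed R' j r := fun j r h0 h1 =>
    elapsed_congr h0 fun u h2 h3 => ih u h2 (h3.trans_le h1) j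
  -- The algorithm at time `r` sees all of `[0,r]`, so the statuses must agree at every `u` between
  -- `s` and `r`, not only at `r`.
  have hev : ∀ᶠ r in 𝓝[≥] s, ∀ u, s ≤ u → u ≤ r → ∀ j, status I R j u = status I R' j u := by
    have h1 : ∀ᶠ r in 𝓝[≥] s, ∀ j, status I R j r = status I R' j r := by
      refine eventually_all.2 fun j => ?_
      filter_upwards [hR.eventually_completed_iff I.p j hs, hR.eventually_signalled_iff I j hs,
        hR'.eventually_completed_iff I.p j hs, hR'.eventually_signalled_iff I j hs]
        with r h1 h2 h3 h4
      have h5 : Completed I.p R j s ↔ Completed I.p R' j s := by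
        unfold Completed; rw [he j s hs le_rfl]
      have h6 : Signalled I R j s ↔ Signalled I R' j s := by
        unfold Signalled; rw [he j s hs le_rfl]
      unfold status
      rw [propext (h1.trans (h5.trans h3.symm)), propext (h2.trans (h6.trans h4.symm))]
    obtain ⟨u, hu, hsub⟩ := (mem_nhdsGE_iff_exists_Ico_subset).1 h1
    filter_upwards [Ico_mem_nhdsGE hu] with r hr v hv hvr
    exact hsub ⟨hv, hvr.trans_lt hr.2⟩
  filter_upwards [hev, self_mem_nhdsWithin] with r hr hsr j
  have hr0 : 0 ≤ r := hs.trans hsr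
  rw [h.2 r hr0, h'.2 r hr0]
  congr 1
  funext i u
  rcases le_total (u : ℝ) s with hus | hus
  · unfold status Signalled Completed
    rw [he i u u.2.1 hus]
  · exact hr u hus u.2.2 i

/-- Transfers the run property from the constructed schedule to any schedule the algorithm produces.
The two are only known to agree at nonnegative times. -/
theorem IsRoundRobinQueueRun.congr {m : ℕ} {α : ℝ} {I : JobInstance n}
    {R R' : Fin n → ℝ → ℝ} {E Q S : ℝ → Finset (Fin n)}
    (h : IsRoundRobinQueueRun m α I R E Q S) (hRR : ∀ t, 0 ≤ t → ∀ j, R j t = R' j t) :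
    IsRoundRobinQueueRun m α I R' E Q S := by
  have he : ∀ j t, 0 ≤ t → elapsed R j t = elapsed R' j t := fun j t ht =>
    elapsed_congr ht fun r hr _ => hRR r hr j
  have hC : ∀ j t, 0 ≤ t → (Completed I.p R j t ↔ Completed I.p R' j t) := fun j t ht => by
    unfold Completed; rw [he j t ht]
  have hG : ∀ j t, 0 ≤ t → (Signalled I R j t ↔ Signalled I R' j t) := fun j t ht => by
    unfold Signalled; rw [he j t ht]
  have hσ : ∀ j, signalTime I R j = signalTime I R' j := fun j => by
    unfold signalTime
    congr 1
    ext t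
    exact and_congr_right fun ht => hG j t ht
  have hσ0 : ∀ j, 0 ≤ signalTime I R j := fun j => Real.sInf_nonneg fun t ht => ht.1
  refine ⟨fun t ht j => ?_, fun t ht j => ?_, fun t ht j => ?_, fun t ht j hj => ?_,
    fun t ht j hj => ?_, fun t ht j hS hE => ?_⟩
  · rw [h.mem_Q t ht, hC j t ht, hG j t ht, he j _ (hσ0 j), hσ]
  · rw [h.mem_E t ht, hC j t ht]
  · rw [h.mem_S t ht]
    have hB : QueuedBefore I R = QueuedBefore I R' := by
      funext i j
      simp only [QueuedBefore, hσ]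
    rw [hB]
  · rw [← hRR t ht, h.rate_S t ht j hj]
  · rw [← hRR t ht, h.rate_E t ht j hj]
  · rw [← hRR t ht, h.rate_other t ht j hS hE]

/-- Knowing the observations until time `t`, run the rule on any instance consistent with them. -/
def roundRobinQueue (m : ℕ) (α : ℝ) : OnlineAlgorithm := by
  classical
  exact fun n t obs j =>
    if h : ∃ R : Fin n → ℝ → ℝ, ∃ (I : JobInstance n) (S : ℝ → Finset (Fin n)),
      FollowsRule m α I R S ∧ ∀ i (s : Set.Icc (0 : ℝ) t), status I R i s = obs i s
    then h.choose j t else 0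

/-- The run chosen inside `roundRobinQueue` may belong to another instance, but its observations on
`[0,t]` are the same. By `eq_of_status_eq` its rates at `t` are then the same too. -/
theorem FollowsRule.eq_roundRobinQueue {m : ℕ} {α : ℝ} {I : JobInstance n} {R : Fin n → ℝ → ℝ}
    {S : ℝ → Finset (Fin n)} (h : FollowsRule m α I R S) {t : ℝ} (ht : 0 ≤ t) (j : Fin n) :
    R j t = roundRobinQueue m α n t (fun i s => status I R i s) j := by
  have hex : ∃ R' : Fin n → ℝ → ℝ, ∃ (I' : JobInstance n) (S' : ℝ → Finset (Fin n)),
      FollowsRule m α I' R' S' ∧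
        ∀ i (s : Set.Icc (0 : ℝ) t), status I' R' i s = status I R i s :=
    ⟨R, I, S, h, fun _ _ => rfl⟩
  unfold roundRobinQueue
  rw [dif_pos hex]
  obtain ⟨I', S', h', hst⟩ := hex.choose_spec
  exact ((h.eq_of_status_eq h' fun i r h0 h1 => (hst i ⟨r, h0, h1⟩).symm) t ht le_rfl).2 j

end

/-! ### Ranks in a finite linear order, and feasibility of the rule. -/

section

section rank

variable {ι κ : Type*} [LinearOrder κ] {key : ι → κ} {lt : ι → ι → Prop} [DecidableRel lt]

theorem rank_lt_card (hlt : ∀ i j, lt i j ↔ key i < key j) {Q : Finset ι} {j : ι} (hj : j ∈ Q) :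
    (Q.filter fun i => lt i j).card < Q.card := by
  refine Finset.card_lt_card (Finset.filter_ssubset.2 ⟨j, hj, ?_⟩)
  rw [hlt]
  exact lt_irrefl _

theorem rank_lt_rank (hlt : ∀ i j, lt i j ↔ key i < key j) {Q : Finset ι} {i j : ι} (hi : i ∈ Q)
    (hij : lt i j) : (Q.filter fun k => lt k i).card < (Q.filter fun k => lt k j).card := by
  refine Finset.card_lt_card (Finset.ssubset_iff_of_subset ?_ |>.2 ⟨i, by simp [hi, hij], ?_⟩)
  · intro k hk
    rw [Finset.mem_filter, hlt] at hk ⊢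
    exact ⟨hk.1, hk.2.trans ((hlt _ _).1 hij)⟩
  · simp [hlt]

theorem rank_injOn (hlt : ∀ i j, lt i j ↔ key i < key j) (hkey : Function.Injective key)
    (Q : Finset ι) : Set.InjOn (fun j => (Q.filter fun i => lt i j).card) Q := by
  intro i hi j hj hij
  by_contra hne
  rcases lt_or_gt_of_ne (hkey.ne hne) with h | h
  · exact (rank_lt_rank hlt hi ((hlt i j).2 h)).ne hij
  · exact (rank_lt_rank hlt hj ((hlt j i).2 h)).ne' hij

/-- Ranks are distinct and below `Q.card`, so by counting they take each value exactly once. -/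
theorem image_rank (hlt : ∀ i j, lt i j ↔ key i < key j) (hkey : Function.Injective key)
    (Q : Finset ι) : Q.image (fun j => (Q.filter fun i => lt i j).card) = Finset.range Q.card := by
  refine Finset.eq_of_subset_of_card_le (fun k hk => ?_) ?_
  · obtain ⟨j, hj, rfl⟩ := Finset.mem_image.1 hk
    exact Finset.mem_range.2 (rank_lt_card hlt hj)
  · rw [Finset.card_image_of_injOn (rank_injOn hlt hkey Q), Finset.card_range]

theorem card_filter_rank_lt (hlt : ∀ i j, lt i j ↔ key i < key j) (hkey : Function.Injective key)
    (Q : Finset ι) (m : ℕ) :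
    (Q.filter fun j => (Q.filter fun i => lt i j).card < m).card = min Q.card m := by
  rw [← Finset.card_image_of_injOn ((rank_injOn hlt hkey Q).mono (Finset.filter_subset _ _))]
  have : (Q.filter fun j => (Q.filter fun i => lt i j).card < m).image
      (fun j => (Q.filter fun i => lt i j).card) = Finset.range (min Q.card m) := by
    ext k
    rw [Finset.mem_range, lt_min_iff, ← Finset.mem_range, ← image_rank hlt hkey Q]
    simp only [Finset.mem_image, Finset.mem_filter]
    constructor
    · rintro ⟨j, ⟨h1, h2⟩, rfl⟩
      exact ⟨⟨j, h1, rfl⟩, h2⟩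
    · rintro ⟨⟨j, h1, rfl⟩, h2⟩
      exact ⟨j, ⟨h1, h2⟩, rfl⟩
  rw [this, Finset.card_range]

end rank

variable {n : ℕ} {m : ℕ} {α : ℝ} {I : JobInstance n} {R : Fin n → ℝ → ℝ}
  {S : ℝ → Finset (Fin n)}

/-- The place of a job in the FIFO order. -/
def queueKey (I : JobInstance n) (R : Fin n → ℝ → ℝ) (j : Fin n) : ℝ ×ₗ Fin n :=
  toLex (signalTime I R j, j)

theorem queueKey_injective (I : JobInstance n) (R : Fin n → ℝ → ℝ) :
    Function.Injective (queueKey I R) := fun _ _ h => (Prod.ext_iff.1 (toLex.injective h)).2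

theorem queuedBefore_iff (i j : Fin n) :
    QueuedBefore I R i j ↔ queueKey I R i < queueKey I R j := by
  rw [queueKey, queueKey, Prod.Lex.toLex_lt_toLex]
  rfl

theorem card_headSet (t : ℝ) :
    (headSet m α I R S t).card = min (queueSet α I R S t).card m := by
  classical
  exact card_filter_rank_lt queuedBefore_iff (queueKey_injective I R) _ m

theorem ruleRate_nonneg (t : ℝ) (j : Fin n) : 0 ≤ ruleRate m α I R S t j := by
  have : ((headSet m α I R S t).card : ℝ) ≤ m := by
    rw [card_headSet]; exact_mod_cast min_le_right _ _
  unfold ruleRate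
  split_ifs
  · exact zero_le_one
  · exact le_min zero_le_one (div_nonneg (by linarith) (Nat.cast_nonneg _))
  · exact le_rfl

theorem ruleRate_le_one (t : ℝ) (j : Fin n) : ruleRate m α I R S t j ≤ 1 := by
  unfold ruleRate
  split_ifs
  · exact le_rfl
  · exact min_le_left _ _
  · exact zero_le_one

theorem sum_ruleRate_le (t : ℝ) : ∑ j, ruleRate m α I R S t j ≤ m := by
  classical
  set H := headSet m α I R S t with hH
  set E := poolSet α I R S t with hE
  have hHm : (H.card : ℝ) ≤ m := by
    rw [hH, card_headSet]; exact_mod_cast min_le_right _ _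
  set x : ℝ := min 1 (((m : ℝ) - H.card) / E.card) with hx
  have hx0 : 0 ≤ x := le_min zero_le_one (div_nonneg (by linarith) (Nat.cast_nonneg _))
  have hle : ∀ j, ruleRate m α I R S t j ≤ (if j ∈ H then 1 else 0) + if j ∈ E then x else 0 := by
    intro j
    unfold ruleRate
    by_cases h1 : j ∈ H <;> by_cases h2 : j ∈ E <;> simp [← hH, ← hE, h1, h2, ← hx, hx0]
  calc ∑ j, ruleRate m α I R S t j
      ≤ ∑ j, ((if j ∈ H then (1 : ℝ) else 0) + if j ∈ E then x else 0) :=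
        Finset.sum_le_sum fun j _ => hle j
    _ = H.card + E.card * x := by simp [Finset.sum_add_distrib]
    _ ≤ m := by
        have hcx : (E.card : ℝ) * x ≤ m - H.card := by
          rcases (Nat.cast_nonneg (α := ℝ) E.card).eq_or_lt with h | h
          · rw [← h]; linarith
          · calc (E.card : ℝ) * x ≤ E.card * (((m : ℝ) - H.card) / E.card) := by
                  gcongr; exact min_le_right _ _
              _ = m - H.card := by field_simp
        linarith

theorem ruleRate_eq_zero_of_completed {t : ℝ} {j : Fin n} (h : Completed I.p R j t) :
    ruleRate m α I R S t j = 0 := by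
  have hQ : j ∉ headSet m α I R S t := fun hj => (mem_queueSet.1 (headSet_subset hj)).1 h
  have hE : j ∉ poolSet α I R S t := fun hj => (mem_poolSet.1 hj).1 h
  rw [ruleRate, if_neg hQ, if_neg hE]

theorem FollowsRule.isSchedule (h : FollowsRule m α I R S) : IsSchedule m I.p R where
  measurable := h.unitRates.measurable
  nonneg := h.unitRates.nonneg
  le_one := h.unitRates.le_one
  sum_le t ht := by
    simp only [h.rate t ht]
    exact sum_ruleRate_le t
  completed j t ht hc := by
    rw [h.rate t ht]
    exact ruleRate_eq_zero_of_completed hc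

/-! ### Existence of a run, from event to event. -/

open Classical in
/-- The number of completions, signals, and expiries of preferential execution until time `t`. -/
def progressCount (α : ℝ) (I : JobInstance n) (R : Fin n → ℝ → ℝ) (S : ℝ → Finset (Fin n))
    (t : ℝ) : ℕ :=
  (Finset.univ.filter fun j => Completed I.p R j t).card +
    (Finset.univ.filter fun j => Signalled I R j t).card +
    (Finset.univ.filter fun j => Expired α I R S j t).card

theorem progressCount_le (t : ℝ) : progressCount α I R S t ≤ 3 * n := by
  classical
  have h : ∀ P : Fin n → Prop, (Finset.univ.filter P).card ≤ n := fun P =>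
    (Finset.card_filter_le _ _).trans (by simp)
  have h1 := h fun j => Completed I.p R j t
  have h2 := h fun j => Signalled I R j t
  have h3 := h fun j => Expired α I R S j t
  unfold progressCount
  omega

theorem progressCount_congr {R' : Fin n → ℝ → ℝ} {S' : ℝ → Finset (Fin n)} (hR : UnitRates R)
    (hR' : UnitRates R') {t : ℝ} (ht : 0 ≤ t)
    (hr : ∀ j r, 0 ≤ r → r < t → R j r = R' j r) (hs : ∀ r, 0 ≤ r → r < t → S r = S' r) :
    progressCount α I R S t = progressCount α I R' S' t := by
  classical
  have he : ∀ j r, 0 ≤ r → r ≤ t → elapsed R j r = elapsed R' j r := fun j r h0 h1 =>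
    elapsed_congr h0 fun u h2 h3 => hr j u h2 (h3.trans_le h1)
  have hC : ∀ j, Completed I.p R j t ↔ Completed I.p R' j t := fun j => by
    unfold Completed; rw [he j t ht le_rfl]
  have hG : ∀ j r, 0 ≤ r → r ≤ t → (Signalled I R j r ↔ Signalled I R' j r) := fun j r h0 h1 => by
    unfold Signalled; rw [he j r h0 h1]
  have hO : ∀ j, Expired α I R S j t ↔ Expired α I R' S' j t := by
    intro j
    unfold Expired
    rw [← hG j t ht le_rfl]
    refine and_congr_right fun hj => ?_
    rw [(signalTime_congr hR hR' ht (hG j) (hr j) hj).2, timeIn_congr hs]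
  unfold progressCount
  exact congrArg₂ (· + ·) (congrArg₂ (· + ·)
    (congrArg Finset.card (Finset.filter_congr fun j _ => hC j))
    (congrArg Finset.card (Finset.filter_congr fun j _ => hG j t ht le_rfl)))
    (congrArg Finset.card (Finset.filter_congr fun j _ => hO j))

/-- Completion, signal and expiry are irreversible. Each of the three sets can only grow, and equal
cardinalities would force equal sets. -/
theorem UnitRates.progressCount_lt (hR : UnitRates R) {s t : ℝ} (hs : 0 ≤ s) (hst : s ≤ t)
    (h : ¬ SameProgress α I R S t s) : progressCount α I R S s < progressCount α I R S t := by
  classical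
  have hmono : ∀ P P' : Fin n → Prop, (∀ j, P j → P' j) →
      (Finset.univ.filter P).card ≤ (Finset.univ.filter P').card ∧
      ((Finset.univ.filter P').card ≤ (Finset.univ.filter P).card → ∀ j, P' j ↔ P j) := by
    intro P P' hPP
    have hsub : Finset.univ.filter P ⊆ Finset.univ.filter P' :=
      Finset.monotone_filter_right _ fun j _ => hPP j
    refine ⟨Finset.card_le_card hsub, fun hc j => ?_⟩
    have := congrArg (j ∈ ·) (Finset.eq_of_subset_of_card_le hsub hc)
    simpa using this.symm
  obtain ⟨a1, a2⟩ := hmono (fun j => Completed I.p R j s) (fun j => Completed I.p R j t)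
    fun j => hR.completed_mono hs hst
  obtain ⟨b1, b2⟩ := hmono (fun j => Signalled I R j s) (fun j => Signalled I R j t)
    fun j => hR.signalled_mono hs hst
  obtain ⟨c1, c2⟩ := hmono (fun j => Expired α I R S j s)
    (fun j => Expired α I R S j t)
    fun j hj => ⟨hR.signalled_mono hs hst hj.1, hj.2.trans (timeIn_mono S j hst)⟩
  by_contra hlt
  unfold progressCount at hlt
  exact h fun j => ⟨a2 (by omega) j, b2 (by omega) j, c2 (by omega) j⟩

/-- A run of the rule on `[0, T)` extends to a run on `[0, ∞)`. -/
theorem exists_followsRule_of_partial (k : ℕ) : ∀ (R : Fin n → ℝ → ℝ) (S : ℝ → Finset (Fin n))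
    (T : ℝ), 0 ≤ T → UnitRates R → (∀ t, 0 ≤ t → t < T → S t = headSet m α I R S t) →
    (∀ t, 0 ≤ t → t < T → ∀ j, R j t = ruleRate m α I R S t j) →
    3 * n ≤ progressCount α I R S T + k →
    ∃ (R' : Fin n → ℝ → ℝ) (S' : ℝ → Finset (Fin n)), FollowsRule m α I R' S' := by
  induction k with
  | zero => _
  | succ k ih => _
  -- Base case and inductive step share the construction and differ only in the last lines. The
  -- number `k` bounds how many events are still to come.
  all_goals
    intro R S T hT hR hS hRate hk
    -- The rates prescribed at `T` are frozen from `T` on. This follows the rule until the first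
    -- event after `T`.
    set R' : Fin n → ℝ → ℝ := fun j t => if t < T then R j t else ruleRate m α I R S T j with hR'
    set S' : ℝ → Finset (Fin n) := fun t => if t < T then S t else headSet m α I R S T with hS'
    have hU : UnitRates R' := by
      refine ⟨fun j => ?_, fun j t ht => ?_, fun j t ht => ?_⟩
      · exact Measurable.ite measurableSet_Iio (hR.measurable j) measurable_const
      · simp only [hR']
        split_ifs
        exacts [hR.nonneg j t ht, ruleRate_nonneg T j]
      · simp only [hR']
        split_ifs
        exacts [hR.le_one j t ht, ruleRate_le_one T j]
    have hr : ∀ j r, 0 ≤ r → r < T → R j r = R' j r := fun j r _ h => by simp [hR', h]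
    have hs : ∀ r, 0 ≤ r → r < T → S r = S' r := fun r _ h => by simp [hS', h]
    have he : ∀ j r, 0 ≤ r → r ≤ T → elapsed R j r = elapsed R' j r := fun j r h0 h1 =>
      elapsed_congr h0 fun u h2 h3 => hr j u h2 (h3.trans_le h1)
    have hold : ∀ t, 0 ≤ t → t ≤ T → headSet m α I R S t = headSet m α I R' S' t ∧
        ruleRate m α I R S t = ruleRate m α I R' S' t := by
      intro t h0 h1
      refine rule_congr_of_past hR hU h0 (fun j => ?_) (fun j r h2 h3 => ?_)
        (fun j r h2 h3 => hr j r h2 (h3.trans_le h1)) fun r h2 h3 => hs r h2 (h3.trans_le h1)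
      · unfold Completed; rw [he j t h0 h1]
      · unfold Signalled; rw [he j r h2 (h3.trans h1)]
    have hbefore : ∀ t, 0 ≤ t → t < T →
        S' t = headSet m α I R' S' t ∧ ∀ j, R' j t = ruleRate m α I R' S' t j := by
      intro t h0 h1
      obtain ⟨h2, h3⟩ := hold t h0 h1.le
      exact ⟨by rw [← hs t h0 h1, hS t h0 h1, h2],
        fun j => by rw [← hr j t h0 h1, hRate t h0 h1, h3]⟩
    have hafter : ∀ t, T ≤ t → SameProgress α I R' S' t T →
        S' t = headSet m α I R' S' t ∧ ∀ j, R' j t = ruleRate m α I R' S' t j := by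
      intro t h0 h1
      obtain ⟨h2, h3⟩ := hold T hT le_rfl
      obtain ⟨h4, h5⟩ := h1.rule_eq (m := m)
      exact ⟨by rw [h4, ← h2]; simp [hS', h0.not_gt],
        fun j => by rw [h5, ← h3]; simp [hR', h0.not_gt]⟩
    by_cases hall : ∀ t, T ≤ t → SameProgress α I R' S' t T
    · have hrule : ∀ t, 0 ≤ t →
          S' t = headSet m α I R' S' t ∧ ∀ j, R' j t = ruleRate m α I R' S' t j := fun t ht =>
        (lt_or_ge t T).elim (hbefore t ht) fun h => hafter t h (hall t h)
      exact ⟨R', S', hU, fun t ht => (hrule t ht).1, fun t ht => (hrule t ht).2⟩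
    push Not at hall
    set F : Set ℝ := {t | T ≤ t ∧ ¬ SameProgress α I R' S' t T} with hF
    have hne : F.Nonempty := hall
    have hbdd : BddBelow F := ⟨T, fun t ht => ht.1⟩
    have hT' : T ≤ sInf F := le_csInf hne fun t ht => ht.1
    have hsame : ∀ t, T ≤ t → t < sInf F → SameProgress α I R' S' t T := by
      intro t h0 h1
      by_contra hn
      exact absurd (csInf_le hbdd (show t ∈ F from ⟨h0, hn⟩)) (not_le.2 h1)
    -- Progress is constant on a right neighbourhood of each time, so the first event takes place at
    -- the infimum itself.
    have hchange : ¬ SameProgress α I R' S' (sInf F) T := by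
      intro hn
      have hev := hU.eventually_sameProgress α I S' (hT.trans hT')
      obtain ⟨u, hu, hsub⟩ := (mem_nhdsGE_iff_exists_Ico_subset).1 hev
      obtain ⟨r, hrF, hru⟩ := exists_lt_of_csInf_lt hne hu
      have h1 := hsub ⟨csInf_le hbdd hrF, hru⟩
      exact hrF.2 fun j => ⟨(h1 j).1.trans (hn j).1, (h1 j).2.1.trans (hn j).2.1,
        (h1 j).2.2.trans (hn j).2.2⟩
    have hcount := hU.progressCount_lt hT hT' hchange
    rw [← progressCount_congr hR hU hT hr hs] at hcount
    have hrule : ∀ t, 0 ≤ t → t < sInf F →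
        S' t = headSet m α I R' S' t ∧ ∀ j, R' j t = ruleRate m α I R' S' t j := fun t ht h1 =>
      (lt_or_ge t T).elim (hbefore t ht) fun h => hafter t h (hsame t h h1)
  -- With `k = 0` all `3 * n` events have already happened, so a further one is impossible.
  · have := progressCount_le (α := α) (I := I) (R := R') (S := S') (sInf F)
    omega
  · exact ih R' S' (sInf F) (hT.trans hT') hU (fun t h0 h1 => (hrule t h0 h1).1)
      (fun t h0 h1 => (hrule t h0 h1).2) (by omega)

theorem exists_followsRule (m : ℕ) (α : ℝ) (I : JobInstance n) :
    ∃ (R : Fin n → ℝ → ℝ) (S : ℝ → Finset (Fin n)), FollowsRule m α I R S := by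
  refine exists_followsRule_of_partial (3 * n) (fun _ _ => 0) (fun _ => ∅) 0 le_rfl
    ⟨fun _ => measurable_const, fun _ _ _ => le_rfl, fun _ _ _ => zero_le_one⟩ ?_ ?_
    (Nat.le_add_left _ _)
  · exact fun t h0 h1 => absurd h0 h1.not_ge
  · exact fun t h0 h1 => absurd h0 h1.not_ge

theorem roundRobinQueue_produces {m : ℕ} {α : ℝ} (h : FollowsRule m α I R S) :
    (roundRobinQueue m α).Produces m I R :=
  ⟨h.isSchedule, fun _ ht j => h.eq_roundRobinQueue ht j⟩

theorem roundRobinQueue_isAlgorithmFor (m : ℕ) (α : ℝ) :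
    (roundRobinQueue m α).IsAlgorithmFor m := by
  intro n I
  obtain ⟨R, S, h⟩ := exists_followsRule m α I
  exact ⟨R, roundRobinQueue_produces h⟩

theorem roundRobinQueue_isRoundRobinQueue (m : ℕ) (α : ℝ) :
    (roundRobinQueue m α).IsRoundRobinQueue m α := by
  intro n I R hR
  obtain ⟨R', S, h⟩ := exists_followsRule m α I
  exact ⟨_, _, S, h.isRun.congr ((roundRobinQueue_produces h).unique hR)⟩

end

/-! ### Lower bound on the cost of an arbitrary schedule. -/

section

variable {n : ℕ}

/-- Fractional knapsack bound: on `m` machines, `k` jobs whose `i`-th one from the top has weight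
`⌊i/m⌋ + 1` lose at most weighted work `k δ` during a time `δ`. -/
theorem sum_weight_mul_le {ι : Type*} (m : ℕ) (J : Finset ι) (r : ι → ℕ)
    (hinj : Set.InjOn r J) (hr : ∀ j ∈ J, r j < J.card) (Δ : ι → ℝ) (δ : ℝ) (hδ : 0 ≤ δ)
    (h0 : ∀ j ∈ J, 0 ≤ Δ j) (h1 : ∀ j ∈ J, Δ j ≤ δ) (hsum : ∑ j ∈ J, Δ j ≤ m * δ) :
    ∑ j ∈ J, ((r j / m + 1 : ℕ) : ℝ) * Δ j ≤ J.card * δ := by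
  classical
  set k := J.card with hk
  set l := k / m with hl
  -- Ranks below `m * l` have weight at most `l`. The others, at most `k % m` in number, have weight
  -- at most `l + 1`, and their excess is paid by `Δ j ≤ δ`.
  have hle : ∀ j ∈ J, ((r j / m + 1 : ℕ) : ℝ) * Δ j ≤
      l * Δ j + if m * l ≤ r j then δ else 0 := by
    intro j hj
    have hj1 : r j / m ≤ l := Nat.div_le_div_right (hr j hj).le
    split_ifs with h
    · have : ((r j / m + 1 : ℕ) : ℝ) ≤ l + 1 := by exact_mod_cast Nat.succ_le_succ hj1
      nlinarith [h0 j hj, h1 j hj]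
    · have h2 : r j / m < l := by
        rcases Nat.eq_zero_or_pos m with rfl | hm
        · simp at h
        · exact (Nat.div_lt_iff_lt_mul hm).2 (by rw [mul_comm]; omega)
      have : ((r j / m + 1 : ℕ) : ℝ) ≤ l := by exact_mod_cast h2
      nlinarith [h0 j hj]
  have hcard : (J.filter fun j => m * l ≤ r j).card ≤ k % m := by
    have hmap : ∀ j ∈ J.filter (fun j => m * l ≤ r j), r j ∈ Finset.Ico (m * l) k := by
      intro j hj
      rw [Finset.mem_filter] at hj
      exact Finset.mem_Ico.2 ⟨hj.2, hr j hj.1⟩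
    have := Finset.card_le_card_of_injOn r hmap
      (hinj.mono fun x hx => (Finset.mem_filter.1 hx).1)
    rw [Nat.card_Ico] at this
    have h3 := Nat.mod_add_div k m
    rw [← hl] at h3
    omega
  calc ∑ j ∈ J, ((r j / m + 1 : ℕ) : ℝ) * Δ j
      ≤ ∑ j ∈ J, (l * Δ j + if m * l ≤ r j then δ else 0) := Finset.sum_le_sum hle
    _ = l * ∑ j ∈ J, Δ j + (J.filter fun j => m * l ≤ r j).card * δ := by
        rw [Finset.sum_add_distrib, ← Finset.mul_sum, ← Finset.sum_filter, Finset.sum_const,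
          nsmul_eq_mul]
    _ ≤ l * (m * δ) + ((k % m : ℕ) : ℝ) * δ := by
        gcongr
    _ = k * δ := by
        have : ((k % m + m * l : ℕ) : ℝ) = k := by rw [hl, Nat.mod_add_div]
        push_cast at this
        rw [← this]; ring

/-- Lower bound for the total completion time of the remaining jobs `J` from time `s` on. -/
theorem exists_rank_sum_remaining_le {m : ℕ} {p : Fin n → ℝ} {R : Fin n → ℝ → ℝ}
    (hR : IsSchedule m p R) {D : Fin n → ℝ} (hDc : ∀ j, Completed p R j (D j)) (k : ℕ) :
    ∀ (J : Finset (Fin n)) (s : ℝ), J.card = k → 0 ≤ s → (∀ j ∈ J, s ≤ D j) →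
      ∃ r : Fin n → ℕ, Set.InjOn r J ∧ (∀ j ∈ J, r j < k) ∧
        ∑ j ∈ J, ((r j / m + 1 : ℕ) : ℝ) * (p j - elapsed R j s) ≤ ∑ j ∈ J, (D j - s) := by
  induction k with
  | zero =>
    intro J s hJ _ _
    obtain rfl := Finset.card_eq_zero.1 hJ
    exact ⟨fun _ => 0, by simp, by simp, by simp⟩
  | succ k ih =>
    intro J s hJ hs hsD
    have hne : J.Nonempty := Finset.card_pos.1 (by omega)
    obtain ⟨i, hi, hmin⟩ := J.exists_min_image D hne
    have hcard : (J.erase i).card = k := by rw [Finset.card_erase_of_mem hi, hJ]; rfl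
    have hst := hsD i hi
    obtain ⟨r, hinj, hr, hsum⟩ := ih (J.erase i) (D i) hcard (hs.trans hst)
      fun j hj => hmin j (Finset.mem_of_mem_erase hj)
    -- The job completing first gets the largest rank, since ranks count from the end.
    set r' := Function.update r i k with hr'
    have hr'i : r' i = k := by simp [hr']
    have hr'j : ∀ j ∈ J.erase i, r' j = r j := fun j hj =>
      Function.update_of_ne (Finset.ne_of_mem_erase hj) _ _
    have hlt : ∀ j ∈ J, r' j < k + 1 := by
      intro j hj
      by_cases hji : j = i
      · rw [hji, hr'i]; omega
      · have hje := Finset.mem_erase.2 ⟨hji, hj⟩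
        rw [hr'j j hje]
        have := hr j hje
        omega
    have hinj' : Set.InjOn r' J := by
      intro a ha b hb hab
      by_cases hai : a = i <;> by_cases hbi : b = i
      · rw [hai, hbi]
      · have hbe := Finset.mem_erase.2 ⟨hbi, hb⟩
        have := hr b hbe
        rw [hai, hr'i, hr'j b hbe] at hab
        omega
      · have hae := Finset.mem_erase.2 ⟨hai, ha⟩
        have := hr a hae
        rw [hbi, hr'i, hr'j a hae] at hab
        omega
      · have hae := Finset.mem_erase.2 ⟨hai, ha⟩
        have hbe := Finset.mem_erase.2 ⟨hbi, hb⟩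
        rw [hr'j a hae, hr'j b hbe] at hab
        exact hinj hae hbe hab
    refine ⟨r', hinj', hlt, ?_⟩
    have hU := hR.unitRates
    have hknap := sum_weight_mul_le m J r' hinj' (fun j hj => by rw [hJ]; exact hlt j hj)
      (fun j => elapsed R j (D i) - elapsed R j s) (D i - s) (by linarith)
      (fun j _ => sub_nonneg.2 (hU.elapsed_mono j hs hst))
      (fun j _ => by linarith [hU.elapsed_lip j hs hst]) (by
        calc ∑ j ∈ J, (elapsed R j (D i) - elapsed R j s)
            ≤ ∑ j, (elapsed R j (D i) - elapsed R j s) :=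
              Finset.sum_le_sum_of_subset_of_nonneg (Finset.subset_univ _)
                fun j _ _ => sub_nonneg.2 (hU.elapsed_mono j hs hst)
          _ = ∫ x in s..D i, ∑ j, R j x := by
              rw [intervalIntegral.integral_finsetSum
                fun j _ => hU.intervalIntegrable j hs (hs.trans hst)]
              exact Finset.sum_congr rfl fun j _ => hU.elapsed_sub j hs (hs.trans hst)
          _ ≤ ∫ x in s..D i, (m : ℝ) := by
              refine integral_le_of_Ioo hst ?_ (by simp) fun x hx _ => hR.sum_le x (hs.trans hx.le)
              have := IntervalIntegrable.sum (Finset.univ : Finset (Fin n)) (f := R)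
                (a := s) (b := D i) (μ := volume)
                fun j _ => hU.intervalIntegrable j hs (hs.trans hst)
              simpa [Finset.sum_fn] using this
          _ = m * (D i - s) := by simp [mul_comm])
    have hrem : ∑ j ∈ J, ((r' j / m + 1 : ℕ) : ℝ) * (p j - elapsed R j (D i)) ≤
        ∑ j ∈ J.erase i, (D j - D i) := by
      rw [← Finset.add_sum_erase J _ hi]
      -- Job `i` has no work left at `D i`, so its term can be dropped.
      have h1 : ((r' i / m + 1 : ℕ) : ℝ) * (p i - elapsed R i (D i)) ≤ 0 :=
        mul_nonpos_of_nonneg_of_nonpos (Nat.cast_nonneg _) (sub_nonpos.2 (hDc i))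
      have h2 : ∑ j ∈ J.erase i, ((r' j / m + 1 : ℕ) : ℝ) * (p j - elapsed R j (D i)) =
          ∑ j ∈ J.erase i, ((r j / m + 1 : ℕ) : ℝ) * (p j - elapsed R j (D i)) :=
        Finset.sum_congr rfl fun j hj => by rw [hr'j j hj]
      linarith
    have hD : ∑ j ∈ J, (D j - s) = ∑ j ∈ J.erase i, (D j - D i) + J.card * (D i - s) := by
      have h1 := Finset.add_sum_erase J (fun j => D j - D i) hi
      rw [sub_self, zero_add] at h1
      rw [h1, ← nsmul_eq_mul, ← Finset.sum_const, ← Finset.sum_add_distrib]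
      exact Finset.sum_congr rfl fun j _ => by ring
    rw [hD]
    refine le_trans (le_of_eq ?_) (add_le_add hrem hknap)
    rw [← Finset.sum_add_distrib]
    exact Finset.sum_congr rfl fun j _ => by ring

/-- Every schedule costs at least as much as a nonpreemptive list schedule: the `k`-th job from the
end (counted from `0`) delays `⌊k/m⌋ + 1` jobs. -/
theorem exists_rank_sum_le {m : ℕ} {p : Fin n → ℝ} {R : Fin n → ℝ → ℝ}
    (hR : IsSchedule m p R) {D : Fin n → ℝ} (hD : ∀ j, 0 ≤ D j)
    (hDc : ∀ j, Completed p R j (D j)) :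
    ∃ r : Fin n → Fin n, Function.Injective r ∧
        ∑ j, (((r j : ℕ) / m + 1 : ℕ) : ℝ) * p j ≤ ∑ j, D j := by
  obtain ⟨r, hinj, hr, hsum⟩ := exists_rank_sum_remaining_le hR hDc n Finset.univ 0
    (by simp) le_rfl fun j _ => hD j
  refine ⟨fun j => ⟨r j, hr j (Finset.mem_univ j)⟩, fun a b hab => ?_, by simpa using hsum⟩
  exact hinj (by simp) (by simp) (by simpa using hab)

end

/-! ### Structure of a run: rates, busy machines, measurability. -/

section

variable {n m : ℕ} {α : ℝ} {I : JobInstance n} {R : Fin n → ℝ → ℝ}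
  {E Q S : ℝ → Finset (Fin n)}

theorem IsSchedule.elapsed_eq_of_completed {p : Fin n → ℝ} (hS : IsSchedule m p R)
    (hp : ∀ j, 0 ≤ p j) {j : Fin n} {t : ℝ} (ht : 0 ≤ t) (hc : Completed p R j t) :
    elapsed R j t = p j := by
  obtain ⟨C, h0, h1, h2, -, h4, -⟩ := hS.unitRates.completionTime_spec hp ht hc
  have h5 := hS.unitRates.elapsed_sub j h0 ht
  have h6 : ∫ x in C..t, R j x = ∫ x in C..t, (0 : ℝ) :=
    integral_eq_of_Ioo h1 fun x hx _ => hS.completed j x (h0.trans hx.le)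
      (hS.unitRates.completed_mono h0 hx.le h2)
  simp at h6
  linarith

theorem IsSchedule.elapsed_le {p : Fin n → ℝ} (hS : IsSchedule m p R)
    (hp : ∀ j, 0 ≤ p j) {j : Fin n} {t : ℝ} (ht : 0 ≤ t) : elapsed R j t ≤ p j := by
  by_cases hc : Completed p R j t
  · exact (hS.elapsed_eq_of_completed hp ht hc).le
  · exact (not_le.1 hc).le

theorem UnitRates.sum_elapsed (hR : UnitRates R) {s t : ℝ} (hs : 0 ≤ s) (ht : 0 ≤ t) :
    IntervalIntegrable (fun x => ∑ j, R j x) volume s t ∧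
      ∑ j, elapsed R j t - ∑ j, elapsed R j s = ∫ x in s..t, ∑ j, R j x := by
  constructor
  · have := IntervalIntegrable.sum (Finset.univ : Finset (Fin n)) (f := R)
      (a := s) (b := t) (μ := volume) fun j _ => hR.intervalIntegrable j hs ht
    simpa [Finset.sum_fn] using this
  · rw [intervalIntegral.integral_finsetSum fun j _ => hR.intervalIntegrable j hs ht,
      ← Finset.sum_sub_distrib]
    exact Finset.sum_congr rfl fun j _ => hR.elapsed_sub j hs ht

open Classical in
/-- The unfinished jobs. -/
def unfinished (I : JobInstance n) (R : Fin n → ℝ → ℝ) (t : ℝ) : Finset (Fin n) :=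
  Finset.univ.filter fun j => ¬ Completed I.p R j t

theorem mem_unfinished {t : ℝ} {j : Fin n} : j ∈ unfinished I R t ↔ ¬ Completed I.p R j t := by
  simp [unfinished]

theorem UnitRates.unfinished_anti (hR : UnitRates R) {s t : ℝ} (hs : 0 ≤ s) (hst : s ≤ t) :
    unfinished I R t ⊆ unfinished I R s := fun _ hj =>
  mem_unfinished.2 fun hc => mem_unfinished.1 hj (hR.completed_mono hs hst hc)

/-- The indicator function of the times at which job `j` is in preferential execution. -/
def headIndicator (S : ℝ → Finset (Fin n)) (j : Fin n) : ℝ → ℝ :=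
  Set.indicator {s | 0 ≤ s ∧ j ∈ S s} 1

theorem headIndicator_of_mem {t : ℝ} {j : Fin n} (ht : 0 ≤ t) (h : j ∈ S t) :
    headIndicator S j t = 1 :=
  Set.indicator_of_mem (s := {s | 0 ≤ s ∧ j ∈ S s}) ⟨ht, h⟩ 1

theorem headIndicator_of_notMem {t : ℝ} {j : Fin n} (h : j ∉ S t) :
    headIndicator S j t = 0 :=
  Set.indicator_of_notMem (s := {s | 0 ≤ s ∧ j ∈ S s}) (fun hx => h hx.2) 1

theorem headIndicator_nonneg (t : ℝ) (j : Fin n) : 0 ≤ headIndicator S j t :=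
  Set.indicator_nonneg (fun _ _ => zero_le_one) t

theorem headIndicator_le_one (t : ℝ) (j : Fin n) : headIndicator S j t ≤ 1 :=
  Set.indicator_le' (fun _ _ => le_rfl) (fun _ _ => zero_le_one) t

namespace IsRoundRobinQueueRun

theorem head_subset (h : IsRoundRobinQueueRun m α I R E Q S) {t : ℝ} (ht : 0 ≤ t) :
    S t ⊆ Q t := fun j hj => ((h.mem_S t ht j).1 hj).1

theorem queue_subset (h : IsRoundRobinQueueRun m α I R E Q S) {t : ℝ} (ht : 0 ≤ t) :
    Q t ⊆ unfinished I R t := fun j hj => mem_unfinished.2 ((h.mem_Q t ht j).1 hj).1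

theorem pool_eq (h : IsRoundRobinQueueRun m α I R E Q S) {t : ℝ} (ht : 0 ≤ t) :
    E t = unfinished I R t \ Q t := by
  ext j
  rw [h.mem_E t ht, Finset.mem_sdiff, mem_unfinished]

theorem card_pool_add (h : IsRoundRobinQueueRun m α I R E Q S) {t : ℝ} (ht : 0 ≤ t) :
    (E t).card + (Q t).card = (unfinished I R t).card := by
  rw [h.pool_eq ht]
  exact Finset.card_sdiff_add_card_eq_card (h.queue_subset ht)

theorem card_head (h : IsRoundRobinQueueRun m α I R E Q S) {t : ℝ} (ht : 0 ≤ t) :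
    (S t).card = min (Q t).card m := by
  classical
  rw [← card_filter_rank_lt queuedBefore_iff (queueKey_injective I R)]
  congr 1
  ext j
  rw [h.mem_S t ht, Finset.mem_filter]

theorem head_eq_queue (h : IsRoundRobinQueueRun m α I R E Q S) {t : ℝ} (ht : 0 ≤ t)
    (hlt : (Q t).card ≤ m) : S t = Q t :=
  Finset.eq_of_subset_of_card_le (h.head_subset ht) (by rw [h.card_head ht, min_eq_left hlt])

/-- The common rate of the jobs in the Round-Robin set. -/
def poolRate (m : ℕ) (E S : ℝ → Finset (Fin n)) (t : ℝ) : ℝ :=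
  min 1 (((m : ℝ) - ((S t).card : ℝ)) / ((E t).card : ℝ))

theorem card_head_le (h : IsRoundRobinQueueRun m α I R E Q S) {t : ℝ} (ht : 0 ≤ t) :
    ((S t).card : ℝ) ≤ m := by
  rw [h.card_head ht]
  exact_mod_cast min_le_right _ _

theorem poolRate_nonneg (h : IsRoundRobinQueueRun m α I R E Q S) {t : ℝ} (ht : 0 ≤ t) :
    0 ≤ poolRate m E S t :=
  le_min zero_le_one (div_nonneg (sub_nonneg.2 (h.card_head_le ht)) (Nat.cast_nonneg _))

theorem rate_eq (h : IsRoundRobinQueueRun m α I R E Q S) {t : ℝ} (ht : 0 ≤ t) (j : Fin n) :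
    R j t = (if j ∈ S t then 1 else 0) + if j ∈ E t then poolRate m E S t else 0 := by
  by_cases hS : j ∈ S t
  · have hE : j ∉ E t := fun hE => ((h.mem_E t ht j).1 hE).2 (h.head_subset ht hS)
    rw [if_pos hS, if_neg hE, h.rate_S t ht j hS, add_zero]
  · by_cases hE : j ∈ E t
    · rw [if_neg hS, if_pos hE, h.rate_E t ht j hE, zero_add, poolRate]
    · rw [if_neg hS, if_neg hE, h.rate_other t ht j hS hE, zero_add]

theorem sum_rate (h : IsRoundRobinQueueRun m α I R E Q S) {t : ℝ} (ht : 0 ≤ t) :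
    ∑ j, R j t = (S t).card + (E t).card * poolRate m E S t := by
  simp [h.rate_eq ht, Finset.sum_add_distrib]

/-- The whole queue fits into `S`, and `|E| + |S| ≤ m` turns the minimum in the pool rate into `1`.
-/
theorem rate_eq_one (h : IsRoundRobinQueueRun m α I R E Q S) {t : ℝ} (ht : 0 ≤ t)
    (hN : (unfinished I R t).card ≤ m) {j : Fin n} (hj : j ∈ unfinished I R t) : R j t = 1 := by
  have hc := h.card_pool_add ht
  have hSQ := h.head_eq_queue ht (by omega)
  by_cases hQ : j ∈ Q t
  · exact h.rate_S t ht j (hSQ ▸ hQ)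
  · have hE : j ∈ E t := (h.mem_E t ht j).2 ⟨mem_unfinished.1 hj, hQ⟩
    have hpos : (0 : ℝ) < (E t).card := by exact_mod_cast Finset.card_pos.2 ⟨j, hE⟩
    rw [h.rate_E t ht j hE]
    refine min_eq_left ((one_le_div hpos).2 ?_)
    rw [hSQ]
    have : (((E t).card + (Q t).card : ℕ) : ℝ) ≤ m := by exact_mod_cast hc ▸ hN
    push_cast at this
    linarith

/-- No machine idles: a queue longer than `m` fills them all, and otherwise `S = Q` and the pool has
enough jobs to absorb the other `m - |Q|` machines. -/
theorem sum_rate_eq (h : IsRoundRobinQueueRun m α I R E Q S) {t : ℝ} (ht : 0 ≤ t)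
    (hN : m < (unfinished I R t).card) : ∑ j, R j t = m := by
  have hc := h.card_pool_add ht
  rw [h.sum_rate ht, poolRate]
  rcases le_or_gt (Q t).card m with hQ | hQ
  · rw [h.head_eq_queue ht hQ]
    rcases Nat.eq_zero_or_pos (E t).card with hE | hE
    · omega
    have hE' : (0 : ℝ) < (E t).card := by exact_mod_cast hE
    have hle : ((m : ℝ) - (Q t).card) ≤ (E t).card := by
      have : (m : ℝ) ≤ ((E t).card + (Q t).card : ℕ) := by exact_mod_cast (hc ▸ hN).le
      push_cast at this
      linarith
    rw [min_eq_right ((div_le_one hE').2 hle)]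
    field_simp
    ring
  · have : (S t).card = m := by rw [h.card_head ht, min_eq_right hQ.le]
    simp [this]

theorem one_le_sum_rate (h : IsRoundRobinQueueRun m α I R E Q S) (hS : UnitRates R) (hm : 1 ≤ m)
    {t : ℝ} (ht : 0 ≤ t) {j : Fin n} (hj : j ∈ unfinished I R t) : 1 ≤ ∑ j, R j t := by
  rcases le_or_gt (unfinished I R t).card m with hN | hN
  · rw [← h.rate_eq_one ht hN hj]
    exact Finset.single_le_sum (f := fun j => R j t) (fun i _ => hS.nonneg i t ht)
      (Finset.mem_univ j)
  · rw [h.sum_rate_eq ht hN]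
    exact_mod_cast hm

/-- Every job completes. -/
theorem completed_sum (h : IsRoundRobinQueueRun m α I R E Q S) (hS : IsSchedule m I.p R)
    (hm : 1 ≤ m) (j : Fin n) : Completed I.p R j (∑ i, I.p i) := by
  by_contra hc
  have hp : ∀ j, 0 ≤ I.p j := fun j => (I.p_pos j).le
  have hP : 0 ≤ ∑ i, I.p i := Finset.sum_nonneg fun j _ => hp j
  obtain ⟨hint, hsum⟩ := hS.unitRates.sum_elapsed le_rfl hP
  -- If `j` were unfinished, the total rate would be at least `1` throughout. All of `∑ p` would
  -- then have been processed, with work on `j` still missing.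
  have h1 : ∫ x in (0 : ℝ)..∑ i, I.p i, (1 : ℝ) ≤ ∫ x in (0 : ℝ)..∑ i, I.p i, ∑ j, R j x :=
    integral_le_of_Ioo hP (by simp) hint fun x hx hx' =>
      h.one_le_sum_rate hS.unitRates hm hx.le (j := j)
        (hS.unitRates.unfinished_anti hx.le hx'.le (mem_unfinished.2 hc))
  have h2 : ∑ i, elapsed R i (∑ i, I.p i) < ∑ i, I.p i :=
    Finset.sum_lt_sum (fun i _ => hS.elapsed_le hp hP) ⟨j, Finset.mem_univ j, not_le.1 hc⟩
  simp at h1 hsum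
  linarith

/-- A run carries no measurability assumption on its sets. Queue times are differences of up-closed
subsets of `[0,∞)`, which are order-connected and hence measurable. -/
theorem measurableSet_queue (h : IsRoundRobinQueueRun m α I R E Q S) (hR : UnitRates R)
    (j : Fin n) : MeasurableSet {s : ℝ | 0 ≤ s ∧ j ∈ Q s} := by
  have hup : ∀ P : ℝ → Prop, (∀ s t, 0 ≤ s → s ≤ t → P s → P t) →
      MeasurableSet {s : ℝ | 0 ≤ s ∧ P s} := fun P hP =>
    Set.OrdConnected.measurableSet
      ⟨fun x hx y _ z hz => ⟨hx.1.trans hz.1, hP x z hx.1 hz.1 hx.2⟩⟩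
  have h1 := hup (fun s => Completed I.p R j s) fun s t hs hst => hR.completed_mono hs hst
  have h2 := hup (fun s => Signalled I R j s) fun s t hs hst => hR.signalled_mono hs hst
  have h3 := hup (fun s => elapsed R j (signalTime I R j) * ((1 - α) / α) ≤ timeIn S j s)
    fun s t _ hst hle => hle.trans (timeIn_mono S j hst)
  have : {s : ℝ | 0 ≤ s ∧ j ∈ Q s} = ({s : ℝ | 0 ≤ s ∧ Signalled I R j s} \
      {s : ℝ | 0 ≤ s ∧ Completed I.p R j s}) \
      {s | 0 ≤ s ∧ elapsed R j (signalTime I R j) * ((1 - α) / α) ≤ timeIn S j s} := by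
    ext s
    simp only [Set.mem_sdiff, Set.mem_ofPred_eq]
    constructor
    · rintro ⟨hs, hj⟩
      obtain ⟨a, b, c⟩ := (h.mem_Q s hs j).1 hj
      exact ⟨⟨⟨hs, b⟩, fun hx => a hx.2⟩, fun hx => absurd hx.2 (not_le.2 c)⟩
    · rintro ⟨⟨⟨hs, b⟩, a⟩, c⟩
      exact ⟨hs, (h.mem_Q s hs j).2 ⟨fun hx => a ⟨hs, hx⟩, b, not_le.1 fun hx => c ⟨hs, hx⟩⟩⟩
  rw [this]
  exact (h2.diff h1).diff h3

theorem measurableSet_head (h : IsRoundRobinQueueRun m α I R E Q S) (hR : UnitRates R)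
    (j : Fin n) : MeasurableSet {s : ℝ | 0 ≤ s ∧ j ∈ S s} := by
  classical
  have hcard : Measurable fun s : ℝ =>
      ∑ i, if QueuedBefore I R i j then Set.indicator {s : ℝ | 0 ≤ s ∧ i ∈ Q s} (1 : ℝ → ℕ) s
        else 0 := by
    refine Finset.measurable_sum _ fun i _ => ?_
    split_ifs
    · exact measurable_one.indicator (h.measurableSet_queue hR i)
    · exact measurable_const
  have : {s : ℝ | 0 ≤ s ∧ j ∈ S s} = {s : ℝ | 0 ≤ s ∧ j ∈ Q s} ∩ {s : ℝ |
      (∑ i, if QueuedBefore I R i j then Set.indicator {s : ℝ | 0 ≤ s ∧ i ∈ Q s} (1 : ℝ → ℕ) s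
        else 0) < m} := by
    ext s
    simp only [Set.mem_inter_iff, Set.mem_ofPred_eq, and_assoc]
    refine and_congr_right fun hs => ?_
    rw [h.mem_S s hs]
    refine and_congr_right fun _ => ?_
    have : ((Q s).filter fun i => QueuedBefore I R i j).card =
        ∑ i, if QueuedBefore I R i j then Set.indicator {s : ℝ | 0 ≤ s ∧ i ∈ Q s} (1 : ℝ → ℕ) s
        else 0 := by
      rw [Finset.card_filter, ← Finset.sum_subset (Finset.subset_univ (Q s))]
      · refine Finset.sum_congr rfl fun i hi => ?_
        simp [Set.indicator, hs, hi]
      · intro i _ hi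
        simp [Set.indicator, hi]
    rw [this]
  rw [this]
  exact (h.measurableSet_queue hR j).inter (hcard measurableSet_Iio)

theorem intervalIntegrable_headIndicator (h : IsRoundRobinQueueRun m α I R E Q S)
    (hR : UnitRates R) (j : Fin n) {s t : ℝ} (hs : 0 ≤ s) (ht : 0 ≤ t) :
    IntervalIntegrable (headIndicator S j) volume s t :=
  intervalIntegrable_of_unit (measurable_one.indicator (h.measurableSet_head hR j))
    (fun t _ => headIndicator_nonneg t j) (fun t _ => headIndicator_le_one t j) hs ht

theorem timeIn_eq_integral (h : IsRoundRobinQueueRun m α I R E Q S)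
    (hR : UnitRates R) (j : Fin n) {t : ℝ} (ht : 0 ≤ t) :
    timeIn S j t = ∫ s in (0 : ℝ)..t, headIndicator S j s := by
  rw [intervalIntegral.integral_of_le ht, headIndicator,
    integral_indicator_one (h.measurableSet_head hR j),
    measureReal_restrict_apply (h.measurableSet_head hR j)]
  refine measureReal_congr ?_
  have : ∀ᵐ x : ℝ, x ≠ 0 := by simp [ae_iff]
  filter_upwards [this] with x hx
  refine propext ⟨fun hx' => ⟨⟨hx'.1.1, hx'.2⟩, lt_of_le_of_ne hx'.1.1 hx.symm, hx'.1.2⟩,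
    fun hx' => ⟨⟨hx'.1.1, hx'.2.2⟩, hx'.1.2⟩⟩

theorem timeIn_sub (h : IsRoundRobinQueueRun m α I R E Q S)
    (hR : UnitRates R) (j : Fin n) {s t : ℝ} (hs : 0 ≤ s) (ht : 0 ≤ t) :
    timeIn S j t - timeIn S j s = ∫ x in s..t, headIndicator S j x := by
  rw [h.timeIn_eq_integral hR j hs, h.timeIn_eq_integral hR j ht]
  exact intervalIntegral.integral_interval_sub_left
    (h.intervalIntegrable_headIndicator hR j le_rfl ht)
    (h.intervalIntegrable_headIndicator hR j le_rfl hs)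

theorem headIndicator_le_rate (h : IsRoundRobinQueueRun m α I R E Q S) (hR : UnitRates R)
    (j : Fin n) {t : ℝ} (ht : 0 ≤ t) : headIndicator S j t ≤ R j t := by
  by_cases hj : j ∈ S t
  · rw [h.rate_S t ht j hj]
    exact headIndicator_le_one t j
  · rw [headIndicator_of_notMem hj]
    exact hR.nonneg j t ht

/-- The difference is the processing received outside `S`. At the signal it equals `ρ_j`, and so it
is at least `ρ_j` ever after. -/
theorem elapsed_sub_timeIn_mono (h : IsRoundRobinQueueRun m α I R E Q S) (hR : UnitRates R)
    (j : Fin n) {s t : ℝ} (hs : 0 ≤ s) (hst : s ≤ t) :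
    elapsed R j s - timeIn S j s ≤ elapsed R j t - timeIn S j t := by
  have ht := hs.trans hst
  have h1 := hR.elapsed_sub j hs ht
  have h2 := h.timeIn_sub hR j hs ht
  have h3 := integral_le_of_Ioo hst (h.intervalIntegrable_headIndicator hR j hs ht)
    (hR.intervalIntegrable j hs ht) fun x hx _ => h.headIndicator_le_rate hR j (hs.trans hx.le)
  linarith

theorem timeIn_signalTime (h : IsRoundRobinQueueRun m α I R E Q S) (hR : UnitRates R)
    {j : Fin n} {t : ℝ} (ht : 0 ≤ t) (hj : Signalled I R j t) :
    timeIn S j (signalTime I R j) = 0 := by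
  obtain ⟨-, -, -, h3, -⟩ := hR.signalTime_spec ht hj
  exact timeIn_eq_zero fun r hr hlt hjr =>
    h3 r hr hlt ((h.mem_Q r hr j).1 (h.head_subset hr hjr)).2.1

/-- The processing in preferential execution is at most `(1-α)/α` times the one outside of it. -/
theorem timeIn_le (h : IsRoundRobinQueueRun m α I R E Q S) (hR : UnitRates R) (hα0 : 0 < α)
    (hα1 : α ≤ 1) (j : Fin n) {t : ℝ} (ht : 0 ≤ t) :
    timeIn S j t ≤ (elapsed R j t - timeIn S j t) * ((1 - α) / α) := by
  have hq : 0 ≤ (1 - α) / α := div_nonneg (by linarith) hα0.le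
  have hmono := h.elapsed_sub_timeIn_mono hR j le_rfl ht
  set G : Set ℝ := {r | r ∈ Set.Icc 0 t ∧ j ∈ S r} with hG
  by_cases hne : G.Nonempty
  swap
  · have h0 : ∀ x, 0 ≤ x → timeIn S j (min x t) = 0 := fun x hx =>
      timeIn_eq_zero fun r hr hrx hj => hne ⟨r, ⟨hr, (hrx.le.trans (min_le_right _ _))⟩, hj⟩
    have h1 := h0 t ht
    have h2 := h0 0 le_rfl
    rw [min_self] at h1
    rw [min_eq_left ht] at h2
    rw [h2, elapsed_zero, sub_zero] at hmono
    calc timeIn S j t = 0 := h1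
      _ ≤ _ := mul_nonneg hmono hq
  have hbdd : BddAbove G := ⟨t, fun r hr => hr.1.2⟩
  have hst : sSup G ≤ t := csSup_le hne fun r hr => hr.1.2
  have heq : timeIn S j t = timeIn S j (sSup G) := by
    unfold timeIn
    congr 1
    ext x
    refine ⟨fun hx => ⟨⟨hx.1.1, le_csSup hbdd hx⟩, hx.2⟩,
      fun hx => ⟨⟨hx.1.1, hx.1.2.trans hst⟩, hx.2⟩⟩
  -- The job need not be in `S` at the supremum, so the queue condition is used at a time within `ε`
  -- of it.
  refine le_of_forall_pos_le_add fun ε hε => ?_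
  obtain ⟨r, hr, hlt⟩ := exists_lt_of_lt_csSup hne (sub_lt_self (sSup G) hε)
  obtain ⟨-, h1, h2⟩ := (h.mem_Q r hr.1.1 j).1 (h.head_subset hr.1.1 hr.2)
  have h3 := timeIn_lip S j (le_csSup hbdd hr)
  obtain ⟨a, b, -⟩ := hR.signalTime_spec hr.1.1 h1
  have h4 := h.elapsed_sub_timeIn_mono hR j a (b.trans hr.1.2)
  rw [h.timeIn_signalTime hR hr.1.1 h1, sub_zero] at h4
  have h5 := mul_le_mul_of_nonneg_right h4 hq
  linarith

/-- An unfinished `j` runs at least at the pool rate. The only case at issue is `j` waiting in the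
queue outside `S`, but then `S` occupies all machines and the pool rate is `0`. -/
theorem rate_sub_headIndicator_le (h : IsRoundRobinQueueRun m α I R E Q S) (hR : UnitRates R)
    (i : Fin n) {j : Fin n} {t : ℝ} (ht : 0 ≤ t) (hj : j ∈ unfinished I R t) :
    R i t - headIndicator S i t ≤ R j t := by
  by_cases hi : i ∈ S t
  · rw [h.rate_S t ht i hi, headIndicator_of_mem ht hi, sub_self]
    exact hR.nonneg j t ht
  rw [headIndicator_of_notMem hi, sub_zero]
  by_cases hiE : i ∈ E t
  swap
  · rw [h.rate_other t ht i hi hiE]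
    exact hR.nonneg j t ht
  by_cases hjQ : j ∈ Q t
  swap
  · rw [h.rate_E t ht i hiE, h.rate_E t ht j ((h.mem_E t ht j).2 ⟨mem_unfinished.1 hj, hjQ⟩)]
  by_cases hjS : j ∈ S t
  · rw [h.rate_S t ht j hjS]
    exact hR.le_one i t ht
  · have hlt : m < (Q t).card := by
      by_contra! hle
      exact hjS (h.head_eq_queue ht hle ▸ hjQ)
    have hcard : (S t).card = m := by rw [h.card_head ht, min_eq_right hlt.le]
    rw [h.rate_E t ht i hiE, hcard, sub_self, zero_div, min_eq_right zero_le_one]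
    exact hR.nonneg j t ht

/-- While job `j` is unfinished, no job has received more than `1/α` times the processing
of `j`. -/
theorem elapsed_le_div (h : IsRoundRobinQueueRun m α I R E Q S) (hR : UnitRates R) (hα0 : 0 < α)
    (hα1 : α ≤ 1) (i : Fin n) {j : Fin n} {t : ℝ} (ht : 0 ≤ t)
    (hj : ∀ s, 0 ≤ s → s < t → ¬ Completed I.p R j s) :
    elapsed R i t ≤ 1 / α * elapsed R j t := by
  have h1 : elapsed R i t - timeIn S i t ≤ elapsed R j t := by
    rw [h.timeIn_eq_integral hR i ht, elapsed, elapsed, ← intervalIntegral.integral_sub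
      (hR.intervalIntegrable i le_rfl ht) (h.intervalIntegrable_headIndicator hR i le_rfl ht)]
    exact integral_le_of_Ioo ht ((hR.intervalIntegrable i le_rfl ht).sub
      (h.intervalIntegrable_headIndicator hR i le_rfl ht)) (hR.intervalIntegrable j le_rfl ht)
      fun x hx hxt => h.rate_sub_headIndicator_le hR i hx.le (mem_unfinished.2 (hj x hx.le hxt))
  have h2 := h.timeIn_le hR hα0 hα1 i ht
  have h3 : elapsed R i t ≤ 1 / α * (elapsed R i t - timeIn S i t) := by
    have : (elapsed R i t - timeIn S i t) * ((1 - α) / α) =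
        1 / α * (elapsed R i t - timeIn S i t) - (elapsed R i t - timeIn S i t) := by
      field_simp
    linarith
  exact h3.trans (mul_le_mul_of_nonneg_left h1 (by positivity))

end IsRoundRobinQueueRun

/-! ### Robustness. -/

/-- Sum over pairs, each pair being ordered by an injective function. -/
theorem sum_sum_eq_of_injective {ι κ : Type*} [Fintype ι] [LinearOrder κ]
    {r : ι → κ} (hr : Function.Injective r) (f : ι → ι → ℝ) :
    ∑ j, ∑ i, f i j = ∑ j, f j j + ∑ j, ∑ i with r i < r j, (f i j + f j i) := by
  classical
  have h1 : ∀ i j, f i j = (if i = j then f i j else 0) + (if r i < r j then f i j else 0) +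
      if r j < r i then f i j else 0 := by
    intro i j
    rcases lt_trichotomy (r i) (r j) with h | h | h
    · have : i ≠ j := fun hij => h.ne (congrArg r hij)
      simp [h, h.not_gt, this]
    · simp [hr h]
    · have : i ≠ j := fun hij => h.ne' (congrArg r hij)
      simp [h, h.not_gt, this]
  have h2 : ∑ j, ∑ i, f i j = ∑ j, ∑ i, (if i = j then f i j else 0) +
      ∑ j, ∑ i, (if r i < r j then f i j else 0) +
      ∑ j, ∑ i, if r j < r i then f i j else 0 := by
    simp only [← Finset.sum_add_distrib, ← h1]
  rw [h2, Finset.sum_comm (f := fun j i => if r j < r i then f i j else 0)]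
  simp only [Finset.sum_ite_eq', Finset.mem_univ, if_true, Finset.sum_filter,
    Finset.sum_add_distrib, add_assoc]

/-- `C` is the vector of completion times of the schedule `R`. -/
def IsCompletionVector (p : Fin n → ℝ) (R : Fin n → ℝ → ℝ) (C : Fin n → ℝ) : Prop :=
  ∀ j, 0 ≤ C j ∧ Completed p R j (C j) ∧ ∀ s, 0 ≤ s → s < C j → ¬ Completed p R j s

/-- Robustness, compared to an arbitrary order of the jobs in a nonpreemptive list schedule. -/
theorem IsRoundRobinQueueRun.sum_le_robust (h : IsRoundRobinQueueRun m α I R E Q S)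
    (hS : IsSchedule m I.p R) (hm : 1 ≤ m) (hα0 : 0 < α) (hα1 : α ≤ 1) {C : Fin n → ℝ}
    (hC : IsCompletionVector I.p R C) {r : Fin n → Fin n} (hr : Function.Injective r) :
    ∑ j, C j ≤ (1 + 1 / α) * ∑ j, (((r j : ℕ) / m + 1 : ℕ) : ℝ) * I.p j := by
  classical
  have hp : ∀ j, 0 ≤ I.p j := fun j => (I.p_pos j).le
  have hR := hS.unitRates
  set A : Set ℝ := {t | 0 ≤ t ∧ (unfinished I R t).card ≤ m} with hA
  have hne : A.Nonempty := by
    refine ⟨∑ i, I.p i, Finset.sum_nonneg fun j _ => hp j, ?_⟩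
    have : unfinished I R (∑ i, I.p i) = ∅ := Finset.eq_empty_of_forall_notMem fun j hj =>
      mem_unfinished.1 hj (h.completed_sum hS hm j)
    simp [this]
  have hbdd : BddBelow A := ⟨0, fun t ht => ht.1⟩
  set T := sInf A with hT
  have hT0 : 0 ≤ T := le_csInf hne fun t ht => ht.1
  have hbefore : ∀ t, 0 ≤ t → t < T → m < (unfinished I R t).card := by
    intro t h0 h1
    by_contra! hle
    exact absurd (csInf_le hbdd (show t ∈ A from ⟨h0, hle⟩)) (not_le.2 h1)
  have hafter : ∀ t, T < t → (unfinished I R t).card ≤ m := by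
    intro t h1
    obtain ⟨s, hs, hst⟩ := exists_lt_of_csInf_lt hne h1
    exact (Finset.card_le_card (hR.unfinished_anti hs.1 hst.le)).trans hs.2
  set τ : Fin n → ℝ := fun j => min (C j) T with hτ
  have hτ0 : ∀ j, 0 ≤ τ j := fun j => le_min (hC j).1 hT0
  set x : Fin n → ℝ := fun j => elapsed R j T with hx
  have hx0 : ∀ j, 0 ≤ x j := fun j => by
    simpa using hR.elapsed_mono j le_rfl hT0
  have hxp : ∀ j, x j ≤ I.p j := fun j => hS.elapsed_le hp hT0
  -- After `T` at most `m` jobs remain and each runs at rate `1`, so the rest of `j` takes exactly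
  -- its remaining work.
  have hsplit : ∀ j, C j = τ j + (I.p j - x j) := by
    intro j
    obtain ⟨c0, c1, c2⟩ := hC j
    rcases le_or_gt (C j) T with hle | hlt
    · have : x j = I.p j :=
        hS.elapsed_eq_of_completed hp hT0 (hR.completed_mono c0 hle c1)
      simp [hτ, hle, this]
    · have h1 := hR.elapsed_sub j hT0 c0
      rw [hS.elapsed_eq_of_completed hp c0 c1] at h1
      have h2 : ∫ s in T..C j, R j s = ∫ s in T..C j, (1 : ℝ) :=
        integral_eq_of_Ioo hlt.le fun s hs hs' =>
          h.rate_eq_one (hT0.trans hs.le) (hafter s hs)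
            (mem_unfinished.2 (c2 s (hT0.trans hs.le) hs'))
      simp only [intervalIntegral.integral_const, smul_eq_mul, mul_one] at h2
      simp only [hτ, min_eq_right hlt.le, hx]
      linarith
  have hwork : ∀ j, m * τ j = ∑ i, elapsed R i (τ j) := by
    intro j
    have h1 := (hR.sum_elapsed le_rfl (hτ0 j)).2
    have h2 : ∫ s in (0 : ℝ)..τ j, ∑ i, R i s = ∫ s in (0 : ℝ)..τ j, (m : ℝ) :=
      integral_eq_of_Ioo (hτ0 j) fun s hs hs' =>
        h.sum_rate_eq hs.le (hbefore s hs.le (hs'.trans_le (min_le_right _ _)))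
    simp at h1 h2
    linarith
  have hfixed : ∀ i j, τ i ≤ τ j → elapsed R i (τ j) = elapsed R i (τ i) := by
    intro i j hij
    rcases le_or_gt (C i) T with hle | hlt
    · have hi : τ i = C i := min_eq_left hle
      have hc : Completed I.p R i (τ i) := hi ▸ (hC i).2.1
      rw [hS.elapsed_eq_of_completed hp (hτ0 i) hc,
        hS.elapsed_eq_of_completed hp (hτ0 j) (hR.completed_mono (hτ0 i) hij hc)]
    · have hi : τ i = T := min_eq_right hlt.le
      rw [le_antisymm (hi ▸ min_le_right _ _ : τ j ≤ τ i) hij]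
  -- Both terms may be evaluated at `min (τ i) (τ j)`, before which `j` is unfinished. There
  -- `elapsed_le_div` applies. The statement holds for both orders of the pair, so either member can
  -- be charged.
  have hpair : ∀ i j, elapsed R i (τ j) + elapsed R j (τ i) ≤ (1 + 1 / α) * x j := by
    have hmid : ∀ i j t, 0 ≤ t → t ≤ τ j →
        elapsed R i t + elapsed R j t ≤ (1 + 1 / α) * x j := by
      intro i j t h0 h1
      have h2 := h.elapsed_le_div hR hα0 hα1 i h0 fun s hs hst =>
        (hC j).2.2 s hs (hst.trans_le (h1.trans (min_le_left _ _)))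
      have h3 : elapsed R j t ≤ x j := hR.elapsed_mono j h0 (h1.trans (min_le_right _ _))
      have h4 : 1 / α * elapsed R j t ≤ 1 / α * x j :=
        mul_le_mul_of_nonneg_left h3 (by positivity)
      linarith
    intro i j
    rcases le_total (τ i) (τ j) with hij | hij
    · rw [hfixed i j hij]
      exact hmid i j _ (hτ0 i) hij
    · rw [hfixed j i hij]
      exact hmid i j _ (hτ0 j) le_rfl
  have hκ : 1 ≤ 1 + 1 / α := by
    have : 0 < 1 / α := by positivity
    linarith
  have hmpos : (0 : ℝ) < m := by exact_mod_cast hm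
  -- Each pair is charged to its member of larger `r`. Job `j` pays for at most `r j` pairs and the
  -- diagonal term, and `r j + 1 ≤ m * (r j / m + 1)`.
  have hsum1 : m * ∑ j, τ j ≤ m * ((1 + 1 / α) * ∑ j, (((r j : ℕ) / m + 1 : ℕ) : ℝ) * x j) := by
    rw [Finset.mul_sum, Finset.sum_congr rfl fun j _ => hwork j,
      sum_sum_eq_of_injective hr fun i j => elapsed R i (τ j), ← Finset.sum_add_distrib,
      Finset.mul_sum, Finset.mul_sum]
    refine Finset.sum_le_sum fun j _ => ?_
    have hcard : ((Finset.univ.filter fun i => r i < r j).card : ℝ) ≤ (r j : ℕ) := by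
      have := Finset.card_le_card_of_injOn (s := Finset.univ.filter fun i => r i < r j)
        (t := Finset.Iio (r j)) r (fun i hi => by simpa using hi) hr.injOn
      rw [Fin.card_Iio] at this
      exact_mod_cast this
    have h1 : ∑ i with r i < r j, (elapsed R i (τ j) + elapsed R j (τ i)) ≤
        (r j : ℕ) * ((1 + 1 / α) * x j) := by
      calc ∑ i with r i < r j, (elapsed R i (τ j) + elapsed R j (τ i))
          ≤ ∑ i with r i < r j, (1 + 1 / α) * x j := Finset.sum_le_sum fun i _ => hpair i j
        _ = (Finset.univ.filter fun i => r i < r j).card * ((1 + 1 / α) * x j) := by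
            rw [Finset.sum_const, nsmul_eq_mul]
        _ ≤ _ := mul_le_mul_of_nonneg_right hcard
            (mul_nonneg (zero_le_one.trans hκ) (hx0 j))
    have h2 : elapsed R j (τ j) ≤ (1 + 1 / α) * x j :=
      (hR.elapsed_mono j (hτ0 j) (min_le_right _ _)).trans (le_mul_of_one_le_left (hx0 j) hκ)
    have h3 : (((r j : ℕ) + 1 : ℕ) : ℝ) ≤ (m * ((r j : ℕ) / m + 1) : ℕ) := by
      exact_mod_cast Nat.lt_mul_div_succ (r j : ℕ) hm
    have h4 := mul_le_mul_of_nonneg_right h3 (mul_nonneg (zero_le_one.trans hκ) (hx0 j))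
    push_cast at h4 ⊢
    linarith
  have hsum2 := le_of_mul_le_mul_left hsum1 hmpos
  -- For the work after `T` it suffices that all weights are at least `1`.
  have hsum3 : ∑ j, (I.p j - x j) ≤
      (1 + 1 / α) * ∑ j, (((r j : ℕ) / m + 1 : ℕ) : ℝ) * (I.p j - x j) := by
    rw [Finset.mul_sum]
    refine Finset.sum_le_sum fun j _ => ?_
    rw [← mul_assoc]
    refine le_mul_of_one_le_left (sub_nonneg.2 (hxp j)) (one_le_mul_of_one_le_of_one_le hκ ?_)
    exact_mod_cast Nat.le_add_left 1 _
  calc ∑ j, C j = ∑ j, τ j + ∑ j, (I.p j - x j) := by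
        rw [← Finset.sum_add_distrib]
        exact Finset.sum_congr rfl fun j _ => hsplit j
    _ ≤ _ := add_le_add hsum2 hsum3
    _ = _ := by
        rw [← mul_add, ← Finset.sum_add_distrib]
        congr 1
        exact Finset.sum_congr rfl fun j _ => by ring

end

/-! ### Weight inequalities and ranks for the consistency bound. -/

section

section weights

/-- Moving the window by one replaces the weight of `a` by that of `a + m`, which is larger by one.
-/
theorem sum_Ico_div_add_one (m : ℕ) (hm : 1 ≤ m) (a : ℕ) :
    ∑ i ∈ Finset.Ico a (a + m), (i / m + 1) = a + m := by
  induction a with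
  | zero =>
    rw [zero_add, Finset.sum_congr rfl (g := fun _ => 1) fun i hi => by
      rw [Nat.div_eq_of_lt (Finset.mem_Ico.1 hi).2]]
    simp
  | succ a ih =>
    have h1 := Finset.sum_Ico_succ_top (a := a) (b := a + m) (by omega) fun i => i / m + 1
    have h2 := Finset.sum_eq_sum_Ico_succ_bot (a := a) (b := a + m + 1) (by omega)
      fun i => i / m + 1
    rw [Nat.add_div_right _ hm] at h1
    rw [show a + 1 + m = a + m + 1 by ring]
    omega

/-- The weights of `i` and `k - 1 - i` add up to at least `(k - 1) / m + 1`. This is where work in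
the pool comes to be counted twice. -/
theorem mul_le_two_mul_sum_range (m : ℕ) (hm : 1 ≤ m) (k : ℕ) :
    k * ((k - 1) / m + 1) ≤ 2 * ∑ i ∈ Finset.range k, (i / m + 1) := by
  have h1 : 2 * ∑ i ∈ Finset.range k, (i / m + 1) =
      ∑ i ∈ Finset.range k, ((i / m + 1) + ((k - 1 - i) / m + 1)) := by
    have h0 := Finset.sum_range_reflect (fun i => i / m + 1) k
    rw [two_mul]
    nth_rewrite 2 [← h0]
    rw [← Finset.sum_add_distrib]
  have h2 : k * ((k - 1) / m + 1) = ∑ i ∈ Finset.range k, ((k - 1) / m + 1) := by simp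
  rw [h1, h2]
  refine Finset.sum_le_sum fun i hi => ?_
  have hik := Finset.mem_range.1 hi
  have h3 := Nat.lt_mul_div_succ i hm
  have h4 := Nat.lt_mul_div_succ (k - 1 - i) hm
  have h5 : (k - 1) / m < i / m + 1 + ((k - 1 - i) / m + 1) := by
    refine Nat.div_lt_of_lt_mul ?_
    rw [mul_add]
    omega
  omega

/-- Weighted work done by `s` machines on the `s` heaviest jobs and by `m - s` machines on the
other `k` jobs. -/
theorem add_le_weighted_work {m s : ℕ} (hm : 1 ≤ m) (hs : s ≤ m) (k : ℕ) :
    ((k + s : ℕ) : ℝ) ≤ ∑ i ∈ Finset.Ico k (k + s), ((i / m + 1 : ℕ) : ℝ) +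
      2 * min 1 (((m : ℝ) - s) / k) * ∑ i ∈ Finset.range k, ((i / m + 1 : ℕ) : ℝ) := by
  have hone : ∀ A : Finset ℕ, A.card ≤ ∑ i ∈ A, (i / m + 1) := fun A => by
    rw [Finset.card_eq_sum_ones]
    exact Finset.sum_le_sum fun i _ => Nat.le_add_left 1 _
  have hIco : s ≤ ∑ i ∈ Finset.Ico k (k + s), (i / m + 1) := by
    simpa using hone (Finset.Ico k (k + s))
  have hrange : k ≤ ∑ i ∈ Finset.range k, (i / m + 1) := by simpa using hone (Finset.range k)
  have hmul := mul_le_two_mul_sum_range m hm k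
  rw [← Nat.cast_sum, ← Nat.cast_sum]
  set A := ∑ i ∈ Finset.Ico k (k + s), (i / m + 1) with hA
  set B := ∑ i ∈ Finset.range k, (i / m + 1) with hB
  have hA' : (s : ℝ) ≤ A := by exact_mod_cast hIco
  have hB' : (k : ℝ) ≤ B := by exact_mod_cast hrange
  rcases Nat.eq_zero_or_pos k with rfl | hk
  · simpa [hB] using hA'
  have hk' : (0 : ℝ) < k := by exact_mod_cast hk
  push_cast
  rcases le_or_gt (k + s) m with hle | hlt
  · have : (k : ℝ) + s ≤ m := by exact_mod_cast hle
    rw [min_eq_left ((one_le_div hk').2 (by linarith))]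
    linarith
  · have hlt' : (m : ℝ) ≤ k + s := by exact_mod_cast hlt.le
    rw [min_eq_right ((div_le_one hk').2 (by linarith))]
    -- The last `m` weights sum to exactly `k + s`. The `m - s` of them below `k` are at most `q`
    -- each, and `k * q ≤ 2 * B` pays for these at rate `(m - s) / k`.
    have h1 := sum_Ico_div_add_one m hm (k + s - m)
    rw [Nat.sub_add_cancel hlt.le,
      ← Finset.sum_Ico_consecutive _ (show k + s - m ≤ k by omega) (Nat.le_add_right k s)] at h1
    have h2 : ∑ i ∈ Finset.Ico (k + s - m) k, (i / m + 1) ≤ (m - s) * ((k - 1) / m + 1) := by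
      have h3 : ∀ i ∈ Finset.Ico (k + s - m) k, i / m + 1 ≤ (k - 1) / m + 1 := fun i hi => by
        have := (Finset.mem_Ico.1 hi).2
        exact Nat.succ_le_succ (Nat.div_le_div_right (by omega))
      have h4 := Finset.sum_le_card_nsmul _ _ _ h3
      rwa [Nat.card_Ico, show k - (k + s - m) = m - s by omega, smul_eq_mul] at h4
    set q := (k - 1) / m + 1 with hq
    have h5 : (k : ℝ) + s ≤ (m - s) * q + A := by
      have : k + s ≤ (m - s) * q + A := by omega
      have h6 : ((k + s : ℕ) : ℝ) ≤ (((m - s) * q + A : ℕ) : ℝ) := by exact_mod_cast this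
      push_cast [Nat.cast_sub hs] at h6
      exact h6
    have h7 : (k : ℝ) * q ≤ 2 * B := by exact_mod_cast hmul
    have h8 : ((m : ℝ) - s) * q ≤ 2 * (((m : ℝ) - s) / k) * B := by
      have h9 : 0 ≤ ((m : ℝ) - s) / k :=
        div_nonneg (sub_nonneg.2 (by exact_mod_cast hs)) hk'.le
      calc ((m : ℝ) - s) * q = ((m : ℝ) - s) / k * (k * q) := by field_simp
        _ ≤ ((m : ℝ) - s) / k * (2 * B) := mul_le_mul_of_nonneg_left h7 h9
        _ = _ := by ring
    linarith

end weights

section rank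

variable {ι κ : Type*} [LinearOrder κ] {key : ι → κ} {lt : ι → ι → Prop}
  [DecidableRel lt]

theorem sum_rank (hlt : ∀ i j, lt i j ↔ key i < key j) (hkey : Function.Injective key)
    (Q : Finset ι) (g : ℕ → ℝ) :
    ∑ j ∈ Q, g (Q.filter fun i => lt i j).card = ∑ k ∈ Finset.range Q.card, g k := by
  rw [← image_rank hlt hkey Q, Finset.sum_image (rank_injOn hlt hkey Q)]

/-- Sums over the ranks of the members of a final segment `S` and of its complement. -/
theorem sum_rank_split [DecidableEq ι] (hlt : ∀ i j, lt i j ↔ key i < key j) (hkey : Function.Injective key)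
    {U S : Finset ι} (hSU : S ⊆ U) (hS : ∀ i ∈ S, ∀ j ∈ U \ S, lt j i) (g : ℕ → ℝ) :
    ∑ j ∈ U \ S, g (U.filter fun i => lt i j).card = ∑ k ∈ Finset.range (U \ S).card, g k ∧
      ∑ j ∈ S, g (U.filter fun i => lt i j).card =
        ∑ k ∈ Finset.Ico (U \ S).card ((U \ S).card + S.card), g k := by
  have h1 : ∑ j ∈ U \ S, g (U.filter fun i => lt i j).card =
      ∑ k ∈ Finset.range (U \ S).card, g k := by
    rw [← sum_rank hlt hkey]
    refine Finset.sum_congr rfl fun j hj => ?_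
    congr 2
    ext i
    simp only [Finset.mem_filter, Finset.mem_sdiff]
    refine ⟨fun hi => ⟨⟨hi.1, fun hiS => ?_⟩, hi.2⟩, fun hi => ⟨hi.1.1, hi.2⟩⟩
    exact lt_asymm ((hlt _ _).1 hi.2) ((hlt _ _).1 (hS i hiS j hj))
  refine ⟨h1, ?_⟩
  have h2 := sum_rank hlt hkey U g
  rw [← Finset.sum_sdiff hSU, h1, ← Finset.card_sdiff_add_card_eq_card hSU,
    ← Finset.sum_range_add_sum_Ico g (Nat.le_add_right (U \ S).card S.card)] at h2
  exact add_left_cancel h2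

end rank

/-! ### Consistency with accurate signals. -/

variable {n m : ℕ} {α : ℝ} {I : JobInstance n} {R : Fin n → ℝ → ℝ}
  {E Q S : ℝ → Finset (Fin n)}

/-- Jobs by decreasing processing time, ties by decreasing index. -/
def LongerThan (I : JobInstance n) (i j : Fin n) : Prop :=
  I.p j < I.p i ∨ (I.p j = I.p i ∧ j < i)

/-- With accurate signals, jobs of equal length signal together and queue by increasing index. Ties
by decreasing index thus make this order the reverse of the FIFO order. -/
def lengthKey (I : JobInstance n) (j : Fin n) : (ℝ ×ₗ Fin n)ᵒᵈ :=
  OrderDual.toDual (toLex (I.p j, j))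

theorem lengthKey_injective (I : JobInstance n) : Function.Injective (lengthKey I) :=
  fun _ _ h => (Prod.ext_iff.1 (toLex.injective (OrderDual.toDual.injective h))).2

theorem longerThan_iff (i j : Fin n) : LongerThan I i j ↔ lengthKey I i < lengthKey I j := by
  rw [lengthKey, lengthKey, OrderDual.toDual_lt_toDual, Prod.Lex.toLex_lt_toLex]
  rfl

open Classical in
/-- The number of jobs that are longer than `j`. -/
def lengthRank (I : JobInstance n) (j : Fin n) : ℕ :=
  (Finset.univ.filter fun i => LongerThan I i j).card

theorem lengthRank_lt (j : Fin n) : lengthRank I j < n := by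
  classical
  have := rank_lt_card (Q := Finset.univ) (longerThan_iff (I := I)) (Finset.mem_univ j)
  rw [Finset.card_univ, Fintype.card_fin] at this
  exact this

theorem lengthRank_injective : Function.Injective (lengthRank I) := by
  classical
  have := rank_injOn (longerThan_iff (I := I)) (lengthKey_injective I) Finset.univ
  exact fun i j hij => this (by simp) (by simp) hij

/-- Among nonpreemptive list schedules, shortest processing time first is best. -/
theorem sum_lengthRank_le (I : JobInstance n) (m : ℕ) {r : Fin n → Fin n}
    (hr : Function.Injective r) :
    ∑ j, ((lengthRank I j / m + 1 : ℕ) : ℝ) * I.p j ≤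
      ∑ j, (((r j : ℕ) / m + 1 : ℕ) : ℝ) * I.p j := by
  classical
  have hbij := Finite.injective_iff_bijective.1 hr
  set k : Fin n → Fin n := fun j => ⟨lengthRank I j, lengthRank_lt j⟩ with hk
  have hk' : Function.Bijective k := Finite.injective_iff_bijective.1 fun i j hij =>
    lengthRank_injective (I := I) (by simpa [hk] using hij)
  set σ : Equiv.Perm (Fin n) := (Equiv.ofBijective r hbij).trans (Equiv.ofBijective k hk').symm
    with hσ
  have hkσ : ∀ j, k (σ j) = r j := fun j => (Equiv.ofBijective k hk').apply_symm_apply (r j)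
  -- Longer jobs carry smaller weights. Since `k ∘ σ = r`, the claim is the rearrangement
  -- inequality.
  have hanti : Antivary I.p fun j => (((k j : ℕ) / m + 1 : ℕ) : ℝ) := by
    intro i j hij
    by_contra! hlt
    have h1 : lengthRank I j < lengthRank I i :=
      rank_lt_rank longerThan_iff (Finset.mem_univ j) (Or.inl hlt)
    have h2 : (k j : ℕ) / m + 1 ≤ (k i : ℕ) / m + 1 :=
      Nat.succ_le_succ (Nat.div_le_div_right h1.le)
    exact absurd hij (not_lt.2 (Nat.cast_le.2 h2))
  have := hanti.sum_mul_le_sum_mul_comp_perm (σ := σ)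
  simp only [hkσ] at this
  simp only [mul_comm _ (I.p _)]
  exact this

/-- The signals of the instance are emitted exactly at the announced fraction. -/
def IsAccurate (α : ℝ) (I : JobInstance n) : Prop := ∀ j, I.β j = α

namespace IsRoundRobinQueueRun

theorem signalled_of_completed (hα1 : α ≤ 1) (hβ : IsAccurate α I)
    {t : ℝ} {j : Fin n} (hc : Completed I.p R j t) : Signalled I R j t := by
  unfold Signalled
  rw [hβ j]
  exact le_trans (mul_le_of_le_one_left (I.p_pos j).le hα1) hc

/-- With accurate signals a job without signal is unfinished, hence in `E`, and all jobs of `E`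
share one rate. -/
theorem elapsed_eq_of_not_signalled (h : IsRoundRobinQueueRun m α I R E Q S) (hα1 : α ≤ 1)
    (hβ : IsAccurate α I) {s : ℝ} (hs : 0 ≤ s) {i j : Fin n}
    (hi : ∀ r, 0 ≤ r → r < s → ¬ Signalled I R i r)
    (hj : ∀ r, 0 ≤ r → r < s → ¬ Signalled I R j r) : elapsed R i s = elapsed R j s := by
  have hE : ∀ k r, 0 ≤ r → ¬ Signalled I R k r → k ∈ E r := fun k r hr hk =>
    (h.mem_E r hr k).2 ⟨fun hc => hk (signalled_of_completed hα1 hβ hc),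
      fun hQ => hk ((h.mem_Q r hr k).1 hQ).2.1⟩
  exact integral_eq_of_Ioo hs fun r hr hrs => by
    rw [h.rate_E r hr.le i (hE i r hr.le (hi r hr.le hrs)),
      h.rate_E r hr.le j (hE j r hr.le (hj r hr.le hrs))]

theorem elapsed_signalTime (hR : UnitRates R) (hβ : IsAccurate α I) {t : ℝ} (ht : 0 ≤ t)
    {j : Fin n} (hj : Signalled I R j t) : elapsed R j (signalTime I R j) = α * I.p j := by
  rw [(hR.signalTime_spec ht hj).2.2.2.2, hβ j]

/-- With accurate signals, jobs leave the queue only when they complete. -/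
theorem mem_queue_of_signalled (h : IsRoundRobinQueueRun m α I R E Q S) (hR : UnitRates R)
    (hα0 : 0 < α) (hβ : IsAccurate α I) {t : ℝ} (ht : 0 ≤ t) {j : Fin n}
    (hj : Signalled I R j t) (hc : ¬ Completed I.p R j t) : j ∈ Q t := by
  refine (h.mem_Q t ht j).2 ⟨hc, hj, ?_⟩
  obtain ⟨a, b, -⟩ := hR.signalTime_spec ht hj
  have h1 := h.elapsed_sub_timeIn_mono hR j a b
  rw [h.timeIn_signalTime hR ht hj] at h1
  rw [elapsed_signalTime hR hβ ht hj] at h1 ⊢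
  have h2 : elapsed R j t < I.p j := not_le.1 hc
  -- For `ρ_j = α p_j` the allotted time in `S` is exactly the work left after the signal.
  have h3 : α * I.p j * ((1 - α) / α) = I.p j - α * I.p j := by field_simp
  linarith

/-- From its signal to its completion the job is queued and is processed only while in `S`. All work
beyond `α p_j` is therefore done there, at rate `1`. -/
theorem timeIn_of_completed (h : IsRoundRobinQueueRun m α I R E Q S) (hS : IsSchedule m I.p R)
    (hα0 : 0 < α) (hα1 : α ≤ 1) (hβ : IsAccurate α I) {t : ℝ} (ht : 0 ≤ t) {j : Fin n}
    (hc : Completed I.p R j t) : timeIn S j t = (1 - α) * I.p j := by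
  have hR := hS.unitRates
  have hj : Signalled I R j t := signalled_of_completed hα1 hβ hc
  obtain ⟨a, b, c, -⟩ := hR.signalTime_spec ht hj
  have h1 := hR.elapsed_sub j a ht
  have h2 := h.timeIn_sub hR j a ht
  have h3 : ∫ x in signalTime I R j..t, R j x =
      ∫ x in signalTime I R j..t, headIndicator S j x := by
    refine integral_eq_of_Ioo b fun x hx _ => ?_
    have hx0 := a.trans hx.le
    by_cases hcx : Completed I.p R j x
    · rw [hS.completed j x hx0 hcx, headIndicator_of_notMem fun hjS =>
        ((h.mem_Q x hx0 j).1 (h.head_subset hx0 hjS)).1 hcx]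
    · have hQ := h.mem_queue_of_signalled hR hα0 hβ hx0 (hR.signalled_mono a hx.le c) hcx
      by_cases hjS : j ∈ S x
      · rw [h.rate_S x hx0 j hjS, headIndicator_of_mem hx0 hjS]
      · rw [h.rate_other x hx0 j hjS fun hE => ((h.mem_E x hx0 j).1 hE).2 hQ,
          headIndicator_of_notMem hjS]
  rw [h.timeIn_signalTime hR ht hj] at h2
  rw [elapsed_signalTime hR hβ ht hj,
    hS.elapsed_eq_of_completed (fun j => (I.p_pos j).le) ht hc] at h1
  linarith

/-- With accurate signals, the jobs in preferential execution are the shortest unfinished ones. -/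
theorem longerThan_of_mem_head (h : IsRoundRobinQueueRun m α I R E Q S) (hR : UnitRates R)
    (hα0 : 0 < α) (hα1 : α ≤ 1) (hβ : IsAccurate α I) {t : ℝ} (ht : 0 ≤ t) {i j : Fin n}
    (hi : i ∈ S t) (hj : j ∈ unfinished I R t) (hjS : j ∉ S t) : LongerThan I j i := by
  classical
  have hiQ := h.head_subset ht hi
  have hiG := ((h.mem_Q t ht i).1 hiQ).2.1
  obtain ⟨a, b, -, hb, -⟩ := hR.signalTime_spec ht hiG
  have hei := elapsed_signalTime hR hβ ht hiG
  -- If `j` has not signalled before `i`, both have received `α p_i` when `i` signals. What `j` has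
  -- received at its own signal, or by `t` if it has none yet, then compares `p_j` with `p_i`.
  have heq : (∀ r, 0 ≤ r → r < signalTime I R i → ¬ Signalled I R j r) →
      elapsed R j (signalTime I R i) = α * I.p i := fun hjr => by
    rw [← hei]
    exact h.elapsed_eq_of_not_signalled hα1 hβ a hjr hb
  by_cases hjG : Signalled I R j t
  · have hjQ := h.mem_queue_of_signalled hR hα0 hβ ht hjG (mem_unfinished.1 hj)
    have hnb : ¬ QueuedBefore I R j i := fun hji => by
      refine hjS ((h.mem_S t ht j).2 ⟨hjQ, ?_⟩)
      exact (rank_lt_rank queuedBefore_iff hjQ hji).trans ((h.mem_S t ht i).1 hi).2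
    have hij : QueuedBefore I R i j := by
      rw [queuedBefore_iff] at hnb ⊢
      refine lt_of_le_of_ne (not_lt.1 hnb) fun heq => hjS ?_
      exact queueKey_injective I R heq ▸ hi
    obtain ⟨c, d, -, hd, -⟩ := hR.signalTime_spec ht hjG
    have hej := elapsed_signalTime hR hβ ht hjG
    have hle : signalTime I R i ≤ signalTime I R j := by
      rcases hij with hlt | ⟨heq', -⟩
      exacts [hlt.le, heq'.le]
    have h1 := heq fun r hr hlt => hd r hr (hlt.trans_le hle)
    have h2 := hR.elapsed_mono j a hle
    rw [h1, hej] at h2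
    rcases (le_of_mul_le_mul_left h2 hα0).lt_or_eq with hlt | hpp
    · exact Or.inl hlt
    · refine Or.inr ⟨hpp, ?_⟩
      rcases hij with hlt | ⟨-, hlt⟩
      -- With equal lengths, `j` would already have signalled together with `i`.
      · refine absurd ?_ (hd _ a hlt)
        unfold Signalled
        rw [h1, hβ j, hpp]
      · exact hlt
  · have h1 := heq fun r hr hlt hjr => hjG (hR.signalled_mono hr (hlt.le.trans b) hjr)
    have h2 := hR.elapsed_mono j a b
    rw [h1] at h2
    have h3 : elapsed R j t < α * I.p j := by
      have := not_le.1 hjG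
      rwa [hβ j] at this
    exact Or.inl (lt_of_mul_lt_mul_left (h2.trans_lt h3) hα0.le)

/-- With accurate signals, the weighted work decreases at least as fast as the objective
increases. -/
theorem card_unfinished_le (h : IsRoundRobinQueueRun m α I R E Q S) (hR : UnitRates R)
    (hm : 1 ≤ m) (hα0 : 0 < α) (hα1 : α ≤ 1) (hβ : IsAccurate α I) {t : ℝ} (ht : 0 ≤ t) :
    ((unfinished I R t).card : ℝ) ≤
      ∑ j, ((lengthRank I j / m + 1 : ℕ) : ℝ) * (2 * R j t - headIndicator S j t) := by
  classical
  set U := unfinished I R t with hU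
  have hSU : S t ⊆ U := (h.head_subset ht).trans (h.queue_subset ht)
  have hlong : ∀ i ∈ S t, ∀ j ∈ U \ S t, LongerThan I j i := fun i hi j hj =>
    h.longerThan_of_mem_head hR hα0 hα1 hβ ht hi (Finset.mem_sdiff.1 hj).1 (Finset.mem_sdiff.1 hj).2
  set g : ℕ → ℝ := fun k => ((k / m + 1 : ℕ) : ℝ) with hg
  have hg0 : ∀ k, 0 ≤ g k := fun k => Nat.cast_nonneg _
  -- Ranks among the unfinished jobs are at most the global ranks, and those of `S` are exactly the
  -- top ones.
  set rk : Fin n → ℕ := fun j => (U.filter fun i => LongerThan I i j).card with hrk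
  obtain ⟨h1, h2⟩ := sum_rank_split longerThan_iff (lengthKey_injective I) hSU hlong g
  have hgr : ∀ j, g (rk j) ≤ g (lengthRank I j) := fun j => by
    have h3 : rk j ≤ lengthRank I j :=
      Finset.card_le_card (Finset.filter_subset_filter _ (Finset.subset_univ U))
    exact Nat.cast_le.2 (Nat.succ_le_succ (Nat.div_le_div_right h3))
  have hx0 := h.poolRate_nonneg ht
  have hsum : ∑ j, g (lengthRank I j) * (2 * R j t - headIndicator S j t) =
      ∑ j ∈ S t, g (lengthRank I j) + 2 * poolRate m E S t * ∑ j ∈ E t, g (lengthRank I j) := by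
    have h3 : ∀ j, g (lengthRank I j) * (2 * R j t - headIndicator S j t) =
        (if j ∈ S t then g (lengthRank I j) else 0) +
          2 * poolRate m E S t * if j ∈ E t then g (lengthRank I j) else 0 := by
      intro j
      have h4 : headIndicator S j t = if j ∈ S t then 1 else 0 := by
        split_ifs with hj
        exacts [headIndicator_of_mem ht hj, headIndicator_of_notMem hj]
      rw [h.rate_eq ht, h4]
      split_ifs <;> ring
    rw [Finset.sum_congr rfl fun j _ => h3 j, Finset.sum_add_distrib, ← Finset.mul_sum]
    simp
  have hcard : (U \ S t).card + (S t).card = U.card := Finset.card_sdiff_add_card_eq_card hSU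
  have hSm : (S t).card ≤ m := by rw [h.card_head ht]; exact min_le_right _ _
  have hwork := add_le_weighted_work hm hSm (U \ S t).card
  rw [← h1, ← h2, hcard] at hwork
  have hpool : 2 * min 1 (((m : ℝ) - (S t).card) / (U \ S t).card) * ∑ j ∈ U \ S t, g (rk j) ≤
      2 * poolRate m E S t * ∑ j ∈ E t, g (lengthRank I j) := by
    -- If `S` is not full, nobody waits and the pool is all of `U \ S`. If it is full, the left side
    -- vanishes.
    rcases hSm.lt_or_eq with hlt | heq
    · have hQ : S t = Q t := by
        refine h.head_eq_queue ht ?_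
        have := h.card_head ht
        omega
      have hE : E t = U \ S t := by rw [h.pool_eq ht, hQ]
      rw [poolRate, hE]
      rw [poolRate, hE] at hx0
      exact mul_le_mul_of_nonneg_left (Finset.sum_le_sum fun j _ => hgr j) (by linarith)
    · rw [heq, sub_self, zero_div, min_eq_right zero_le_one, mul_zero, zero_mul]
      exact mul_nonneg (by linarith) (Finset.sum_nonneg fun j _ => hg0 _)
  refine hwork.trans ((add_le_add (Finset.sum_le_sum fun j _ => hgr j) hpool).trans ?_)
  exact hsum.ge

/-- Integrates `card_unfinished_le` over time. The total weighted by the rank of `j` is `2 p_j`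
minus its time `(1 - α) p_j` in `S`, which is `(1 + α) p_j`. -/
theorem sum_le_consistent (h : IsRoundRobinQueueRun m α I R E Q S)
    (hS : IsSchedule m I.p R) (hm : 1 ≤ m) (hα0 : 0 < α) (hα1 : α ≤ 1) (hβ : IsAccurate α I)
    {C : Fin n → ℝ} (hC : IsCompletionVector I.p R C) :
    ∑ j, C j ≤ (1 + α) * ∑ j, ((lengthRank I j / m + 1 : ℕ) : ℝ) * I.p j := by
  classical
  have hp : ∀ j, 0 ≤ I.p j := fun j => (I.p_pos j).le
  have hR := hS.unitRates
  set P := ∑ i, I.p i with hP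
  have hP0 : 0 ≤ P := Finset.sum_nonneg fun j _ => hp j
  have hcomp : ∀ j, Completed I.p R j P := h.completed_sum hS hm
  have hCP : ∀ j, C j ≤ P := fun j => not_lt.1 fun hlt => (hC j).2.2 P hP0 hlt (hcomp j)
  set f : Fin n → ℝ → ℝ := fun j s => if s < C j then 1 else 0 with hf
  have hfint : ∀ j s t, 0 ≤ s → 0 ≤ t → IntervalIntegrable (f j) volume s t := fun j s t hs ht => by
    refine intervalIntegrable_of_unit
      (Measurable.ite measurableSet_Iio measurable_const measurable_const) ?_ ?_ hs ht
    · intro r _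
      show 0 ≤ if r < C j then (1 : ℝ) else 0
      split_ifs <;> norm_num
    · intro r _
      show (if r < C j then (1 : ℝ) else 0) ≤ 1
      split_ifs <;> norm_num
  have hfC : ∀ j, ∫ s in (0 : ℝ)..P, f j s = C j := by
    intro j
    have hC0 := (hC j).1
    rw [← intervalIntegral.integral_add_adjacent_intervals (hfint j 0 (C j) le_rfl hC0)
      (hfint j (C j) P hC0 hP0),
      integral_eq_of_Ioo (g := fun _ => 1) hC0 fun s _ hs => if_pos hs,
      integral_eq_of_Ioo (g := fun _ => 0) (hCP j) fun s hs _ => if_neg hs.not_gt]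
    simp
  have hgint : ∀ j, IntervalIntegrable (fun s => ((lengthRank I j / m + 1 : ℕ) : ℝ) *
      (2 * R j s - headIndicator S j s)) volume 0 P := fun j =>
    (((hR.intervalIntegrable j le_rfl hP0).const_mul 2).sub
      (h.intervalIntegrable_headIndicator hR j le_rfl hP0)).const_mul _
  have hgC : ∀ j, ∫ s in (0 : ℝ)..P, ((lengthRank I j / m + 1 : ℕ) : ℝ) *
      (2 * R j s - headIndicator S j s) =
      (1 + α) * (((lengthRank I j / m + 1 : ℕ) : ℝ) * I.p j) := by
    intro j
    rw [intervalIntegral.integral_const_mul, intervalIntegral.integral_sub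
      ((hR.intervalIntegrable j le_rfl hP0).const_mul 2)
      (h.intervalIntegrable_headIndicator hR j le_rfl hP0), intervalIntegral.integral_const_mul,
      ← h.timeIn_eq_integral hR j hP0, h.timeIn_of_completed hS hα0 hα1 hβ hP0 (hcomp j)]
    have := hS.elapsed_eq_of_completed hp hP0 (hcomp j)
    rw [elapsed] at this
    rw [this]
    ring
  have hsumint : ∀ F : Fin n → ℝ → ℝ, (∀ j, IntervalIntegrable (F j) volume 0 P) →
      IntervalIntegrable (fun s => ∑ j, F j s) volume 0 P := fun F hF => by
    have := IntervalIntegrable.sum (Finset.univ : Finset (Fin n)) (f := F) fun j _ => hF j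
    simpa [Finset.sum_fn] using this
  calc ∑ j, C j = ∫ s in (0 : ℝ)..P, ∑ j, f j s := by
        rw [intervalIntegral.integral_finsetSum fun j _ => hfint j 0 P le_rfl hP0]
        exact Finset.sum_congr rfl fun j _ => (hfC j).symm
    _ ≤ ∫ s in (0 : ℝ)..P, ∑ j, ((lengthRank I j / m + 1 : ℕ) : ℝ) *
          (2 * R j s - headIndicator S j s) := by
        refine integral_le_of_Ioo hP0 (hsumint _ fun j => hfint j 0 P le_rfl hP0)
          (hsumint _ hgint) fun s hs _ => ?_
        refine le_trans ?_ (h.card_unfinished_le hR hm hα0 hα1 hβ hs.le)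
        simp only [hf, Finset.sum_boole]
        refine Nat.cast_le.2 (Finset.card_le_card fun j hj => ?_)
        exact mem_unfinished.2 ((hC j).2.2 s hs.le (Finset.mem_filter.1 hj).2)
    _ = _ := by
        rw [intervalIntegral.integral_finsetSum fun j _ => hgint j, Finset.mul_sum]
        exact Finset.sum_congr rfl fun j _ => hgC j

end IsRoundRobinQueueRun

/-! ### Comparison with the optimum and conclusion. -/

theorem UnitRates.exists_isCompletionVector (hR : UnitRates R) {p : Fin n → ℝ}
    (hp : ∀ j, 0 ≤ p j) (hc : ∀ j, ∃ t, 0 ≤ t ∧ Completed p R j t) :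
    ∃ C, IsCompletionVector p R C ∧ totalCompletionTime p R = ENNReal.ofReal (∑ j, C j) := by
  choose t ht hct using hc
  choose C h0 _ h2 h3 _ h5 using fun j => hR.completionTime_spec hp (ht j) (hct j)
  refine ⟨C, fun j => ⟨h0 j, h2 j, h3 j⟩, ?_⟩
  rw [totalCompletionTime, ENNReal.ofReal_sum_of_nonneg fun j _ => h0 j]
  exact Finset.sum_congr rfl fun j _ => h5 j

/-- To bound the cost of an algorithm by the optimum it suffices to compare it with list
schedules. -/
theorem totalCompletionTime_le_mul_opt {c : ℝ} (hc : 0 < c) (hR : UnitRates R)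
    (hcomp : ∀ j, ∃ t, 0 ≤ t ∧ Completed I.p R j t)
    (hle : ∀ C, IsCompletionVector I.p R C → ∀ r : Fin n → Fin n, Function.Injective r →
      ∑ j, C j ≤ c * ∑ j, (((r j : ℕ) / m + 1 : ℕ) : ℝ) * I.p j) :
    totalCompletionTime I.p R ≤ ENNReal.ofReal c * opt m I.p := by
  have hp : ∀ j, 0 ≤ I.p j := fun j => (I.p_pos j).le
  obtain ⟨C, hC, htot⟩ := hR.exists_isCompletionVector hp hcomp
  have hc0 : ENNReal.ofReal c ≠ 0 := (ENNReal.ofReal_pos.2 hc).ne'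
  rw [opt, ENNReal.mul_iInf_of_ne hc0 ENNReal.ofReal_ne_top]
  refine le_iInf fun R' => ?_
  rw [ENNReal.mul_iInf_of_ne hc0 ENNReal.ofReal_ne_top]
  refine le_iInf fun hR' => ?_
  by_cases hfin : ∀ j, ∃ t, 0 ≤ t ∧ Completed I.p R' j t
  · obtain ⟨D, hD, htot'⟩ := hR'.unitRates.exists_isCompletionVector hp hfin
    obtain ⟨r, hr, hrD⟩ := exists_rank_sum_le hR' (fun j => (hD j).1) fun j => (hD j).2.1
    rw [htot, htot', ← ENNReal.ofReal_mul hc.le]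
    exact ENNReal.ofReal_le_ofReal ((hle C hC r hr).trans (mul_le_mul_of_nonneg_left hrD hc.le))
  -- A schedule that never completes some job costs `⊤`, and `c > 0` keeps the right side infinite.
  · push Not at hfin
    obtain ⟨j, hj⟩ := hfin
    have htop : totalCompletionTime I.p R' = ⊤ := by
      refine ENNReal.sum_eq_top.2 ⟨j, Finset.mem_univ j, ?_⟩
      simp only [completionTime, iInf_eq_top]
      exact fun t ht => absurd ht.2 (hj t ht.1)
    rw [htop, ENNReal.mul_top hc0]
    exact le_top

theorem roundRobinQueue_isConsistent (hm : 1 ≤ m) (hα0 : 0 < α) (hα1 : α ≤ 1) :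
    (roundRobinQueue m α).IsConsistent m α (1 + α) := by
  intro n I hβ R hR
  obtain ⟨E, Q, S, h⟩ := roundRobinQueue_isRoundRobinQueue m α n I R hR
  refine totalCompletionTime_le_mul_opt (by linarith) hR.1.unitRates
    (fun j => ⟨_, Finset.sum_nonneg fun j _ => (I.p_pos j).le, h.completed_sum hR.1 hm j⟩)
    fun C hC r hr => ?_
  exact (h.sum_le_consistent hR.1 hm hα0 hα1 hβ hC).trans
    (mul_le_mul_of_nonneg_left (sum_lengthRank_le I m hr) (by linarith))

theorem roundRobinQueue_isRobust (hm : 1 ≤ m) (hα0 : 0 < α) (hα1 : α ≤ 1) :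
    (roundRobinQueue m α).IsRobust m (1 + 1 / α) := by
  intro n I R hR
  obtain ⟨E, Q, S, h⟩ := roundRobinQueue_isRoundRobinQueue m α n I R hR
  exact totalCompletionTime_le_mul_opt (by positivity) hR.1.unitRates
    (fun j => ⟨_, Finset.sum_nonneg fun j _ => (I.p_pos j).le, h.completed_sum hR.1 hm j⟩)
    fun C hC r hr => h.sum_le_robust hR.1 hm hα0 hα1 hC hr

end

end SignalScheduling

end

/-- For every number `m ≥ 1` of machines and every announced fraction `α ∈ (0,1]`, there is a
non-clairvoyant algorithm (the Round-Robin/queue rule) that is `(1+α)`-consistent and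
`(1+1/α)`-robust. -/
theorem mainTheorem7 (m : ℕ) (hm : 1 ≤ m) (α : ℝ) (hα0 : 0 < α) (hα1 : α ≤ 1) :
    ∃ A : SignalScheduling.OnlineAlgorithm,
      A.IsAlgorithmFor m ∧
      A.IsRoundRobinQueue m α ∧
      A.IsConsistent m α (1 + α) ∧
      A.IsRobust m (1 + 1 / α) :=
  ⟨SignalScheduling.roundRobinQueue m α,
    SignalScheduling.roundRobinQueue_isAlgorithmFor m α,
    SignalScheduling.roundRobinQueue_isRoundRobinQueue m α,
    SignalScheduling.roundRobinQueue_isConsistent hm hα0 hα1,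
    SignalScheduling.roundRobinQueue_isRobust hm hα0 hα1⟩
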